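/- **Setting.** Inner products $(\cdot,\cdot)$ are linear in the first slot. Let $\mathcal H$ be a complex Hilbert space, $H$ a self-adjoint operator with spectral measure $E$, $K$ a densely defined operator, $T=H+K$. Let $\Omega$ be a simply connected open subset of the upper half plane such that $\overline\Omega\cap\mathbf R$ is an interval with nonempty interior $I$ and $\hat\Omega:=\Omega\cup I\cup\{\operatorname{Im}\lambda<0\}$ is open. Let $X=X(\Omega)$ be a quasi-complete barreled locally convex Hausdorff space which is a dense subspace of $\mathcal H$ with a topology stronger than that of $\mathcal H$; $X'$ is the space of continuous antilinear functionals on $X$, and $i:X\to X'$, $\langle i\psi|\phi\rangle=(\psi,\phi)$. For a densely defined operator $A$ on $\mathcal H$, its *part in* $X$ is $A$ restricted to $\{\phi\in X\cap D(A): A\phi\in X\}$, and $A^\times$ is the dual of the part of $A^*$ in $X$: $A^\times\mu=\nu$ iff $\langle\nu|\phi\rangle=\langle\mu|A^*\phi\rangle$ for all $\phi\in X\cap D(A^*)$ with $A^*\phi\in X$. Assume: - for $\phi\in X$, $(E(\cdot)\phi,\phi)$ has on $I$ a density $E[\phi,\phi](\omega)$ which continues analytically to $\Omega\cup I$; with $E[\psi,\phi]$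 defined by polarization, $E[\cdot,\cdot](\lambda)$ is separately continuous on $X\times X$ for each $\lambda\in\Omega\cup I$; - there is a dense subspace $Y$ of $X$ with $HY\subset X$ and $K^*Y\subset X$; $K$ is $H$-bounded; the identity $T^*=H+K^*$ holds in $X$, in the sense that the part of $T^*$ in $X$ is contained in the closure (in $X\times X$) of the sum of the parts of $H$ and $K^*$; - $K^\times A(\lambda)iX\subset iX$ for $\lambda\in\hat\Omega$, where $A(\lambda):iX\to X'$ is given by $\langle A(\lambda)i\psi|\phi\rangle=\int_{\mathbf R}\frac{d(E(\omega)\psi,\phi)}{\lambda-\omega}$ if $\operatorname{Im}\lambda<0$, by this integral $+\,2\pi \sqrt{-1}\,E[\psi,\phi](\lambda)$ if $\lambda\in\Omega$, and by the limit of the integral at $\lambda+\sqrt{-1}\,y$, $y\to-0$, if $\lambda\in I$. A *generalized eigenfunction* for $\lambda\in\hat\Omega$ is a nonzero $\mu\in A(\lambda)iX$ with $\mu=A(\lambda)K^\times\mu$; then $\lambda$ is a *generalized eigenvalue*. The *generalized resolvent* is $\mathcal R_\lambda=A(\lambda)(\mathrm{id}-K^\times A(\lambda))^{-1}$. The *generalized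 resolvent set* consists of the $\lambda$ having a neighborhood $V\subset\hat\Omega$ such that for $\lambda'\in V$ the operator $\mathrm{id}-K^\times A(\lambda')$ is injective on $iX$, $\mathcal R_{\lambda'}\circ i$ is densely defined in $X$ and extends to a linear operator $X\to X'$ (denoted by the same symbol) continuous for the weak dual topology of $X'$, and $\{\mathcal R_{\lambda'}i\psi\}_{\lambda'\in V}$ is weakly bounded for each $\psi\in X$; the *generalized spectrum* is its complement in $\hat\Omega$. Assume (S1): $\sqrt{-1}\,T$ generates a $C_0$-semigroup $e^{\sqrt{-1}Tt}$ on $\mathcal H$; and (S2): the operators $(e^{\sqrt{-1}Tt})^*$ map $X$ into itself and form there a $C_0$-semigroup of continuous operators such that for some $\beta\in\mathbf R$ the family $\{e^{-\beta t}(e^{\sqrt{-1}Tt})^*\}_{t\ge0}$ is equicontinuous on $X$. Let $(e^{\sqrt{-1}Tt})^\times$ be the dual on $X'$ of $(e^{\sqrt{-1}Tt})^*|_X$. **Proposition.** (i) For $\mu\in D(T^\times)$, $\xi(t)=(e^{\sqrt{-1}Tt})^\times\mu$ is the unique solution on $[0,\infty)$ of $\frac{d\xi}{dt}=\sqrt{-1}\,T^\times\xi$,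 $\xi(0)=\mu$, in $X'$ with the weak dual topology. If every closed bounded subset of $X$ is compact (Montel), it is also a solution for the strong dual topology. (ii) If $\mu_0$ is a generalized eigenfunction for $\lambda_0\in\hat\Omega$, then $(e^{\sqrt{-1}Tt})^\times\mu_0=e^{\sqrt{-1}\lambda_0t}\mu_0$ for all $t\ge0$. (iii) Let $\lambda_0$ be a generalized eigenvalue and let $\gamma_0$ be a positively oriented rectifiable simple closed curve in the generalized resolvent set which has winding number $1$ about $\lambda_0$ and winding number $0$ about every other point of the generalized spectrum. Let $\Pi_0=\frac1{2\pi\sqrt{-1}}\int_{\gamma_0}\mathcal R_\lambda\,d\lambda:iX\to X'$ be the generalized Riesz projection (Pettis integral in $X'$: $\langle\mathcal R_\lambda i\psi|\phi\rangle$ is integrable along $\gamma_0$ for all $\psi,\phi\in X$, and $\langle\Pi_0i\psi|\phi\rangle=\frac1{2\pi\sqrt{-1}}\int_{\gamma_0}\langle\mathcal R_\lambda i\psi|\phi\rangle\,d\lambda$). Suppose that the identity $T=H+K$ holds in $X$, in the sense that the part of $T$ in $X$ is contained in the closure (in $X\times X$) of the sum of the parts of $H$ and $K$. If $\psi\in X$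 is such that $e^{\sqrt{-1}Tt}\psi\in X$ for all $t\ge0$ and $t\mapsto e^{\sqrt{-1}Tt}\psi$ is continuous in $X$, then, for all $t\ge0$, $(e^{\sqrt{-1}Tt})^\times i\psi=i(e^{\sqrt{-1}Tt}\psi)$ and $$(e^{\sqrt{-1}Tt})^\times\,\Pi_0\,i\psi=\Pi_0\,(e^{\sqrt{-1}Tt})^\times\, i\psi .$$ In particular, if every $\psi\in X$ has this property, then $(e^{\sqrt{-1}Tt})^\times\Pi_0iX\subset\Pi_0iX$ for all $t\ge0$. -/

import Mathlib

open Complex Set Filter Topology MeasureTheory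
open scoped LinearPMap InnerProductSpace

noncomputable section

namespace Rigged

/-! ### Projection-valued measures on the real line -/

/-- A projection-valued (spectral) measure on the Borel sets of `ℝ`. The value of `proj` on
non-measurable sets is irrelevant. -/
structure SpectralMeasure (E : Type*) [NormedAddCommGroup E] [InnerProductSpace ℂ E]
    [CompleteSpace E] where
  proj : Set ℝ → E →L[ℂ] E
  isSelfAdjoint : ∀ B, MeasurableSet B → IsSelfAdjoint (proj B)
  proj_inter : ∀ A B, MeasurableSet A → MeasurableSet B → proj (A ∩ B) = proj A ∘L proj B
  proj_univ : proj univ = 1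
  hasSum_iUnion : ∀ B : ℕ → Set ℝ, (∀ n, MeasurableSet (B n)) →
    Pairwise (Function.onFun Disjoint B) →
    ∀ v, HasSum (fun n => proj (B n) v) (proj (⋃ n, B n) v)

namespace SpectralMeasure

variable {E : Type*} [NormedAddCommGroup E] [InnerProductSpace ℂ E] [CompleteSpace E]

theorem proj_empty (P : SpectralMeasure E) : P.proj ∅ = 0 := by
  ext v
  have h := P.hasSum_iUnion (fun _ => ∅) (fun _ => MeasurableSet.empty)
    (fun _ _ _ => disjoint_bot_left) v
  simpa using (summable_const_iff (P.proj ∅ v)).1 h.summable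

theorem inner_proj (P : SpectralMeasure E) {B : Set ℝ} (hB : MeasurableSet B) (v : E) :
    (inner ℂ v (P.proj B v)).re = ‖P.proj B v‖ ^ 2 := by
  have h1 : P.proj B v = P.proj B (P.proj B v) := by
    conv_lhs => rw [← inter_self B, P.proj_inter B B hB hB]
    rfl
  have h2 : inner ℂ v (P.proj B (P.proj B v)) = inner ℂ (P.proj B v) (P.proj B v) := by
    rw [← ContinuousLinearMap.adjoint_inner_left, (P.isSelfAdjoint B hB).adjoint_eq]
  rw [h1, h2, ← h1, inner_self_eq_norm_sq_to_K]
  norm_cast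

/-- The finite positive measure `B ↦ (E(B) v, v) = ‖E(B) v‖²`. -/
def diag (P : SpectralMeasure E) (v : E) : Measure ℝ :=
  Measure.ofMeasurable (fun B _ => ENNReal.ofReal (‖P.proj B v‖ ^ 2))
    (by simp [P.proj_empty])
    (by
      intro B hB hd
      have h := (P.hasSum_iUnion B hB hd v).mapL (innerSL ℂ v)
      have h' := Complex.hasSum_re h
      simp only [innerSL_apply_apply, P.inner_proj (MeasurableSet.iUnion hB),
        P.inner_proj (hB _)] at h'
      rw [← h'.tsum_eq, ENNReal.ofReal_tsum_of_nonneg (fun n => by positivity) h'.summable])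

theorem diag_apply (P : SpectralMeasure E) (v : E) {B : Set ℝ} (hB : MeasurableSet B) :
    P.diag v B = ENNReal.ofReal (‖P.proj B v‖ ^ 2) :=
  Measure.ofMeasurable_apply B hB

/-- The integral `∫ g(ω) d(E(ω) v, w)` against the complex measure `B ↦ (E(B) v, w)`, which is
reduced to positive measures by polarization. The pairing `(v, w)` is linear in `v` and
antilinear in `w`, that is `(v, w) = inner ℂ w v` in Mathlib's convention. -/
def integral (P : SpectralMeasure E) (g : ℝ → ℂ) (v w : E) : ℂ :=
  4⁻¹ * ∑ k ∈ Finset.range 4, Complex.I ^ k * ∫ ω, g ω ∂(P.diag (v + Complex.I ^ k • w))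

/-- `H = ∫ ω dE(ω)`: the domain of `H` consists of the `v` with `∫ ω² d(E(ω)v, v) < ∞`, and
`(H v, v) = ∫ ω d(E(ω)v, v)` there (which determines `H` by polarization). -/
def IsSpectralMeasureOf (P : SpectralMeasure E) (H : E →ₗ.[ℂ] E) : Prop :=
  (∀ v, v ∈ H.domain ↔ Integrable (fun ω : ℝ => ω ^ 2) (P.diag v)) ∧
  ∀ v : H.domain, inner ℂ (v : E) (H v) = ((∫ ω, ω ∂(P.diag (v : E)) : ℝ) : ℂ)

end SpectralMeasure

/-! ### Rigged Hilbert spaces -/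

/-- The space `X'` of continuous antilinear functionals. Its Mathlib topology is the strong dual
topology (uniform convergence on bounded sets). -/
abbrev AntiDual (X : Type*) [AddCommGroup X] [Module ℂ X] [TopologicalSpace X] :=
  X →L⋆[ℂ] ℂ

/-- The data: a self-adjoint operator `H` with spectral measure `E`, a perturbation `K`, a domain
`Ω ⊆ ℂ`, a space `X = X(Ω)` included in the Hilbert space, and, for each `φ ∈ X`, the function
`density φ`, which on the interval `I` is the density of `(E(·)φ, φ)` and which is analytic
on `Ω ∪ I`. The conditions are in `Data.Assumptions`. -/
structure Data (E X : Type*) [NormedAddCommGroup E] [InnerProductSpace ℂ E] [CompleteSpace E]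
    [AddCommGroup X] [Module ℂ X] [TopologicalSpace X] where
  H : E →ₗ.[ℂ] E
  K : E →ₗ.[ℂ] E
  spec : SpectralMeasure E
  Ω : Set ℂ
  incl : X →L[ℂ] E
  density : X → ℂ → ℂ

namespace Data

section Defs

variable {E X : Type*} [NormedAddCommGroup E] [InnerProductSpace ℂ E] [CompleteSpace E]
  [AddCommGroup X] [Module ℂ X] [TopologicalSpace X]

/-- `T = H + K`, on the intersection of the domains. -/
def T (D : Data E X) : E →ₗ.[ℂ] E := D.H + D.K

/-- The trace on the real line of the closure of `Ω`. -/
def closedInterval (D : Data E X) : Set ℝ := {x | (x : ℂ) ∈ closure D.Ω}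

/-- The open interval `I`. -/
def interval (D : Data E X) : Set ℝ := interior D.closedInterval

/-- The interval `I` as a subset of `ℂ`. -/
def intervalC (D : Data E X) : Set ℂ := (fun x : ℝ => (x : ℂ)) '' D.interval

/-- `Ω̂ = Ω ∪ I ∪ {Im λ < 0}`. -/
def extDomain (D : Data E X) : Set ℂ := D.Ω ∪ D.intervalC ∪ {z | z.im < 0}

/-- The canonical inclusion `i : X → X'`, `⟨iψ | φ⟩ = (ψ, φ)`. -/
def embed (D : Data E X) (ψ : X) : AntiDual X :=
  ((innerSLFlip ℂ (D.incl ψ)).comp D.incl : X →L⋆[ℂ] ℂ)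

theorem embed_apply (D : Data E X) (ψ φ : X) :
    D.embed ψ φ = inner ℂ (D.incl φ) (D.incl ψ) := rfl

/-- `E[ψ, φ](z)`, linear in `ψ` and antilinear in `φ`, obtained from `E[φ, φ](z)` by
polarization. -/
def form (D : Data E X) (ψ φ : X) (z : ℂ) : ℂ :=
  4⁻¹ * ∑ k ∈ Finset.range 4, Complex.I ^ k * D.density (ψ + Complex.I ^ k • φ) z

/-- `∫_ℝ (λ - ω)⁻¹ E[ψ, φ](ω) dω`, that is `∫_ℝ (λ - ω)⁻¹ d(E(ω)ψ, φ)`. -/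
def cauchy (D : Data E X) (l : ℂ) (ψ φ : X) : ℂ :=
  D.spec.integral (fun ω => (l - ω)⁻¹) (D.incl ψ) (D.incl φ)

/-- The graph of the operator `A(λ)`: `D.IsA l ψ μ` means `μ = A(λ) iψ` (for `λ ∈ Ω̂`). -/
structure IsA (D : Data E X) (l : ℂ) (ψ : X) (μ : AntiDual X) : Prop where
  upper : l ∈ D.Ω → ∀ φ, μ φ = D.cauchy l ψ φ + 2 * Real.pi * Complex.I * D.form ψ φ l
  real : l ∈ D.intervalC →
    ∀ φ, Tendsto (fun y : ℝ => D.cauchy (l + y * Complex.I) ψ φ) (𝓝[<] 0) (𝓝 (μ φ))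
  lower : l.im < 0 → ∀ φ, μ φ = D.cauchy l ψ φ

/-- The graph of the part of `A` in `X`: the pairs `(φ, χ)` with `φ ∈ X ∩ D(A)` and
`A φ = χ ∈ X`. -/
def partGraph (D : Data E X) (A : E →ₗ.[ℂ] E) : Set (X × X) :=
  {p | ∃ h : D.incl p.1 ∈ A.domain, A ⟨D.incl p.1, h⟩ = D.incl p.2}

/-- The graph of the sum of the parts of `A` and `B` in `X`, on the common domain. -/
def sumGraph (D : Data E X) (A B : E →ₗ.[ℂ] E) : Set (X × X) :=
  {p | ∃ χ₁ χ₂ : X, (p.1, χ₁) ∈ D.partGraph A ∧ (p.1, χ₂) ∈ D.partGraph B ∧ p.2 = χ₁ + χ₂}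

/-- The graph of `A^× = (A^*)'`, the dual of the part of the Hilbert space adjoint `A^*` in `X`:
`μ ∈ D(A^×)` and `A^× μ = ν`. -/
def IsDual (D : Data E X) (A : E →ₗ.[ℂ] E) (μ ν : AntiDual X) : Prop :=
  ∀ p ∈ D.partGraph A†, ν p.1 = μ p.2

/-- The standing assumptions. -/
structure Assumptions (D : Data E X) : Prop where
  -- the operators
  selfAdjoint : IsSelfAdjoint D.H
  spectral : D.spec.IsSpectralMeasureOf D.H
  dense_K : Dense (D.K.domain : Set E)
  -- the domain
  isOpen_Ω : IsOpen D.Ω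
  simplyConnected_Ω : SimplyConnectedSpace D.Ω
  upper_Ω : ∀ z ∈ D.Ω, 0 < z.im
  ordConnected : D.closedInterval.OrdConnected
  nonempty_interval : D.interval.Nonempty
  isOpen_extDomain : IsOpen D.extDomain
  -- `X` is a dense subspace of the Hilbert space, with a stronger topology
  injective : Function.Injective D.incl
  dense : DenseRange D.incl
  -- the spectral density
  analytic : ∀ φ, AnalyticOnNhd ℂ (D.density φ) (D.Ω ∪ D.intervalC)
  density_eq : ∀ φ, ∀ B ⊆ D.interval, MeasurableSet B →
    inner ℂ (D.incl φ) (D.spec.proj B (D.incl φ)) = ∫ ω in B, D.density φ (ω : ℂ)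
  continuous_left : ∀ z ∈ D.Ω ∪ D.intervalC, ∀ φ, Continuous fun ψ => D.form ψ φ z
  continuous_right : ∀ z ∈ D.Ω ∪ D.intervalC, ∀ ψ, Continuous fun φ => D.form ψ φ z
  -- `H Y ⊆ X` and `K^* Y ⊆ X` for a dense subspace `Y` of `X`
  exists_dense : ∃ Y : Submodule ℂ X, Dense (Y : Set X) ∧
    ∀ y ∈ Y, (∃ χ, (y, χ) ∈ D.partGraph D.H) ∧ (∃ χ, (y, χ) ∈ D.partGraph D.K†)
  -- `K` is `H`-bounded
  domain_le : D.H.domain ≤ D.K.domain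
  bounded : ∃ a b : ℝ, ∀ (v : E) (hH : v ∈ D.H.domain) (hK : v ∈ D.K.domain),
    ‖D.K ⟨v, hK⟩‖ ≤ a * ‖v‖ + b * ‖D.H ⟨v, hH⟩‖
  -- `K^× A(λ) iX ⊆ iX`
  smoothing : ∀ l ∈ D.extDomain, ∀ ψ μ, D.IsA l ψ μ → ∃ χ, D.IsDual D.K μ (D.embed χ)
  -- `T^* = H + K^*` in `X`: the part of `T^*` is contained in the closure of `H + K^*`
  adjoint_eq : D.partGraph D.T† ⊆ closure (D.sumGraph D.H D.K†)

/-! ### Generalized spectrum -/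

/-- `μ` is a generalized eigenfunction of `T` associated with `λ`: a nonzero element of the range
of `A(λ)` with `μ = A(λ) K^× μ`. -/
def IsGenEigenfunction (D : Data E X) (l : ℂ) (μ : AntiDual X) : Prop :=
  μ ≠ 0 ∧ (∃ ψ, D.IsA l ψ μ) ∧ ∃ χ, D.IsDual D.K μ (D.embed χ) ∧ D.IsA l χ μ

/-- Generalized eigenvalues of `T`. -/
def IsGenEigenvalue (D : Data E X) (l : ℂ) : Prop :=
  l ∈ D.extDomain ∧ ∃ μ, D.IsGenEigenfunction l μ

/-- `R` is `ℛ_λ ∘ i` for the generalized resolvent `ℛ_λ = A(λ) (id - K^× A(λ))⁻¹`: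
`id - K^× A(λ)` is injective on `iX`, its range is dense in `X`, and `R : X → X'` is the linear
operator, continuous for the weak dual topology, that extends `A(λ) (id - K^× A(λ))⁻¹` to `X`. -/
structure IsGenResolvent (D : Data E X) (l : ℂ) (R : X →ₗ[ℂ] AntiDual X) : Prop where
  injective : ∀ ψ μ, D.IsA l ψ μ → D.IsDual D.K μ (D.embed ψ) → ψ = 0
  dense : Dense {η : X | ∃ ψ μ χ, D.IsA l ψ μ ∧ D.IsDual D.K μ (D.embed χ) ∧ η = ψ - χ}
  continuous : ∀ φ, Continuous fun ψ => R ψ φ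
  eq : ∀ ψ μ χ, D.IsA l ψ μ → D.IsDual D.K μ (D.embed χ) → R (ψ - χ) = μ

open Classical in
/-- The generalized resolvent `ℛ_λ ∘ i`, with value `0` where it does not exist. -/
def genResolvent (D : Data E X) (l : ℂ) : X →ₗ[ℂ] AntiDual X :=
  if h : ∃ R, D.IsGenResolvent l R then h.choose else 0

/-- The generalized resolvent set. -/
def genResolventSet (D : Data E X) : Set ℂ :=
  {l | ∃ V ∈ 𝓝 l, V ⊆ D.extDomain ∧ (∀ l' ∈ V, ∃ R, D.IsGenResolvent l' R) ∧
    ∀ ψ φ, ∃ C : ℝ, ∀ l' ∈ V, ‖D.genResolvent l' ψ φ‖ ≤ C}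

/-- The generalized spectrum. -/
def genSpectrum (D : Data E X) : Set ℂ := D.extDomain \ D.genResolventSet

/-- The winding number of the closed curve `γ`, parametrized by `[0, 1]`, about `z`. -/
def winding (γ : ℝ → ℂ) (z : ℂ) : ℂ :=
  (2 * Real.pi * Complex.I)⁻¹ * ∫ s in (0 : ℝ)..1, (γ s - z)⁻¹ * deriv γ s

/-- `γ` is a positively oriented rectifiable simple closed curve in `Ω̂` which separates `l` from
the rest of the generalized spectrum. -/
structure Separates (D : Data E X) (γ : ℝ → ℂ) (l : ℂ) : Prop where
  lipschitz : ∃ C, LipschitzOnWith C γ (Icc 0 1)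
  closed : γ 0 = γ 1
  simple : InjOn γ (Ico 0 1)
  mem : ∀ s ∈ Icc (0 : ℝ) 1, γ s ∈ D.genResolventSet
  winding_eq_one : winding γ l = 1
  winding_eq_zero : ∀ z ∈ D.genSpectrum, z ≠ l → winding γ z = 0

/-- `P` is `Π ∘ i` for the generalized Riesz projection `Π = (2πi)⁻¹ ∮_γ ℛ_λ dλ`, a Pettis
integral in `X'`. -/
def IsRieszProjection (D : Data E X) (γ : ℝ → ℂ) (P : X → AntiDual X) : Prop :=
  ∀ ψ φ, IntervalIntegrable (fun s => D.genResolvent (γ s) ψ φ * deriv γ s) volume 0 1 ∧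
    P ψ φ = (2 * Real.pi * Complex.I)⁻¹ *
      ∫ s in (0 : ℝ)..1, D.genResolvent (γ s) ψ φ * deriv γ s

/-! ### Semigroups -/

/-- `iT` generates the `C₀`-semigroup `U t = e^{iTt}`, `t ≥ 0`, on the Hilbert space. -/
structure Generates (D : Data E X) (U : ℝ → E →L[ℂ] E) : Prop where
  zero : U 0 = 1
  add : ∀ s t, 0 ≤ s → 0 ≤ t → U (s + t) = U s ∘L U t
  continuousOn : ∀ v, ContinuousOn (fun t => U t v) (Ici 0)
  generator : ∀ v w, Tendsto (fun t : ℝ => (t : ℂ)⁻¹ • (U t v - v)) (𝓝[>] 0) (𝓝 w) ↔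
    ∃ h : v ∈ D.T.domain, w = Complex.I • D.T ⟨v, h⟩

/-- The adjoints of the operators `U t` restrict to a strongly continuous semigroup of continuous
operators `S t = (U t)^*|_X`, `t ≥ 0`, on `X`. The semigroup law is inherited from `U`. -/
structure AdjointSemigroup (D : Data E X) (U : ℝ → E →L[ℂ] E) (S : ℝ → X →L[ℂ] X) : Prop where
  restrict : ∀ t, 0 ≤ t → ∀ φ, D.incl (S t φ) = ContinuousLinearMap.adjoint (U t) (D.incl φ)
  continuousOn : ∀ φ, ContinuousOn (fun t => S t φ) (Ici 0)

/-- The operator `(e^{iTt})^×` on `X'`, the dual of `S t`. -/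
def dualSemigroup (S : ℝ → X →L[ℂ] X) (t : ℝ) (μ : AntiDual X) : AntiDual X :=
  μ.comp (S t)

/-- `ξ` solves `dξ/dt = iT^× ξ` on `[0, ∞)`, `ξ(0) = μ`, in `X'` with the weak dual topology. -/
def IsWeakSolution (D : Data E X) (ξ : ℝ → AntiDual X) (μ : AntiDual X) : Prop :=
  ξ 0 = μ ∧ ∀ t, 0 ≤ t → ∃ ν, D.IsDual D.T (ξ t) ν ∧
    ∀ φ, HasDerivWithinAt (fun s => ξ s φ) (Complex.I * ν φ) (Ici 0) t

/-- `ξ` solves `dξ/dt = iT^× ξ` on `[0, ∞)`, `ξ(0) = μ`, in `X'` with the strong dual topology. -/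
def IsStrongSolution [IsTopologicalAddGroup X] [ContinuousConstSMul ℂ X] (D : Data E X)
    (ξ : ℝ → AntiDual X) (μ : AntiDual X) : Prop :=
  ξ 0 = μ ∧ ∀ t, 0 ≤ t → ∃ ν, D.IsDual D.T (ξ t) ν ∧
    Tendsto (fun s : ℝ => ((s - t : ℝ) : ℂ)⁻¹ • (ξ s - ξ t)) (𝓝[Ici 0 \ {t}] t) (𝓝 (Complex.I • ν))

/-- `c t = e^{iTt} ψ ∈ X` for all `t ≥ 0`, and `c` is continuous in `X`. -/
def IsOrbit (D : Data E X) (U : ℝ → E →L[ℂ] E) (ψ : X) (c : ℝ → X) : Prop :=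
  ContinuousOn c (Ici 0) ∧ ∀ t, 0 ≤ t → D.incl (c t) = U t (D.incl ψ)

end Defs

/-- For some `β`, the operators `e^{-βt} S t`, `t ≥ 0`, are equicontinuous (`β = 0`: the operators
`S t` are equicontinuous). -/
def QuasiEquicontinuous {X : Type*} [AddCommGroup X] [Module ℂ X] [UniformSpace X]
    (S : ℝ → X →L[ℂ] X) : Prop :=
  ∃ β : ℝ, Equicontinuous fun (t : Ici (0 : ℝ)) (φ : X) => (Real.exp (-β * t) : ℂ) • S t φ

end Data

end Rigged

end

/-! Write `S t` for the restriction of `(U t)^*` to `X`. Since `X` is quasi-complete, Riemann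
integrals of continuous curves exist in `X`, and testing against `D(T)` shows that `C = ∫₀ᵗ S s φ
ds` lies in the part of `T^*`, with `T^* C = i(S t φ - φ)`. Pairing with `μ ∈ D(T^×)` gives `μ(S t
φ) - μ(φ) = i ∫₀ᵗ (T^×μ)(S s φ) ds`, which is the weak equation in (i). On bounded sets of a Montel
space the convergence is uniform, because their closures are compact (`IsDual.isStrongSolution`).

Uniqueness (`IsWeakSolution.eq_dualSemigroup`) is the usual duality argument: for `φ` in the part of
`T^*`, the function `s ↦ ξ(s)(S(t-s)φ)` has zero right derivative on `[0, t)`, and such `φ` are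
dense. The product rule needs joint continuity, which comes from equicontinuity of `S` and, for `ξ`,
from Banach–Steinhaus on the barreled space `X`. Parts (ii) and (iii) then reduce to exhibiting
solutions with the right initial value.

For (ii), spectral calculus and analytic continuation from `I` give `(λ - H^×)A(λ)iψ = iψ`
(`IsA.apply_part`). With `T^* = H + K^*` in `X`, a generalized eigenfunction satisfies `T^×μ = λμ`,
so `e^{iλt}μ` is a solution.

For (iii), `T^×ℛ_λ iψ = λℛ_λ iψ - iψ` (`IsGenResolvent.isDual`), while `ℛ_λ i(λ - T)φ = iφ` on the
part of `T` (`IsGenResolvent.apply_smul_sub`). Applying the latter to `∫₀ᵗ c(s) ds` for an orbit `c`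
shows that `ℛ_λ i c(t)` solves the equation with initial value `ℛ_λ iψ`. Hence the semigroup
commutes with each `ℛ_λ` along the orbit, and integration over the curve gives the claim for `Π₀`.
-/

noncomputable section

namespace Rigged

/-! ### Integrals against families of measures -/

/-- If the total set integrals of a finite family of densities vanish, so does the total integral
of the densities multiplied by a bounded measurable function. -/
theorem sum_integral_mul_eq_zero {α ι : Type*} [MeasurableSpace α] (s : Finset ι)
    (μ : ι → Measure α) [∀ i, IsFiniteMeasure (μ i)] (f : ι → α → ℂ)
    (hf : ∀ i ∈ s, Integrable (f i) (μ i))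
    (h : ∀ B, MeasurableSet B → ∑ i ∈ s, ∫ x in B, f i x ∂(μ i) = 0)
    (g : α → ℂ) (hg : Measurable g) (C : ℝ) (hC : ∀ x, ‖g x‖ ≤ C) :
    ∑ i ∈ s, ∫ x, g x * f i x ∂(μ i) = 0 := by
  classical
  -- The sum dominates every `μ i`, so all the densities can be compared as functions against one
  -- measure.
  set m : Measure α := ∑ i ∈ s, μ i with hm
  have hfin : IsFiniteMeasure m := by
    refine ⟨?_⟩
    rw [hm, Measure.finsetSum_apply]
    exact ENNReal.sum_lt_top.2 fun i _ => measure_lt_top _ _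
  have hac : ∀ i ∈ s, μ i ≪ m := fun i hi =>
    by
    refine Measure.absolutelyContinuous_of_le (Measure.le_iff.2 fun B hB => ?_)
    rw [hm, Measure.finsetSum_apply]
    exact Finset.single_le_sum (f := fun i => μ i B) (fun _ _ => zero_le) hi
  let F : ι → α → ℂ := fun i x => ((μ i).rnDeriv m x).toReal • f i x
  have hF : ∀ i ∈ s, Integrable (F i) m := fun i hi =>
    (integrable_rnDeriv_smul_iff (hac i hi)).2 (hf i hi)
  have hz : (fun x => ∑ i ∈ s, F i x) =ᵐ[m] 0 := by
    refine Integrable.ae_eq_zero_of_forall_setIntegral_eq_zero (integrable_finsetSum _ hF) ?_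
    intro B hB _
    rw [integral_finsetSum _ fun i hi => (hF i hi).integrableOn, ← h B hB]
    exact Finset.sum_congr rfl fun i hi => setIntegral_rnDeriv_smul (hac i hi) hB
  have e : ∀ i ∈ s, ∫ x, g x * f i x ∂(μ i) = ∫ x, g x * F i x ∂m := by
    intro i hi
    rw [← integral_rnDeriv_smul (hac i hi)]
    refine integral_congr_ae (ae_of_all _ fun x => ?_)
    simp only [F, Complex.real_smul]
    ring
  rw [Finset.sum_congr rfl e, ← integral_finsetSum]
  · refine integral_eq_zero_of_ae ?_
    filter_upwards [hz] with x hx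
    rw [← Finset.mul_sum]
    simp only [Pi.zero_apply] at hx ⊢
    rw [hx, mul_zero]
  · intro i hi
    exact (hF i hi).bdd_mul hg.aestronglyMeasurable (ae_of_all _ hC)

/-- The two families are merged over a disjoint union, the second with a minus sign. This is how an
identity between polarized complex measures is extended from sets to functions. -/
theorem sum_integral_mul_eq_sum {α ι κ : Type*} [MeasurableSpace α] (s : Finset ι) (t : Finset κ)
    (μ : ι → Measure α) [∀ i, IsFiniteMeasure (μ i)] (ν : κ → Measure α)
    [∀ i, IsFiniteMeasure (ν i)] (f : ι → α → ℂ) (f' : κ → α → ℂ)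
    (hf : ∀ i ∈ s, Integrable (f i) (μ i)) (hf' : ∀ i ∈ t, Integrable (f' i) (ν i))
    (h : ∀ B, MeasurableSet B →
      ∑ i ∈ s, ∫ x in B, f i x ∂(μ i) = ∑ i ∈ t, ∫ x in B, f' i x ∂(ν i))
    (g : α → ℂ) (hg : Measurable g) (C : ℝ) (hC : ∀ x, ‖g x‖ ≤ C) :
    ∑ i ∈ s, ∫ x, g x * f i x ∂(μ i) = ∑ i ∈ t, ∫ x, g x * f' i x ∂(ν i) := by
  have : ∀ i : ι ⊕ κ, IsFiniteMeasure (Sum.elim μ ν i) := by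
    rintro (i | i) <;> simp only [Sum.elim_inl, Sum.elim_inr] <;> infer_instance
  have key := sum_integral_mul_eq_zero (s.disjSum t) (Sum.elim μ ν)
    (Sum.elim f fun i x => -f' i x) (by
      intro i hi
      rcases Finset.mem_disjSum.1 hi with ⟨a, ha, rfl⟩ | ⟨a, ha, rfl⟩
      · simpa using hf a ha
      · simpa using (hf' a ha).neg) (by
      intro B hB
      rw [Finset.sum_disjSum]
      simp only [Sum.elim_inl, Sum.elim_inr, integral_neg, Finset.sum_neg_distrib, h B hB]
      ring) g hg C hC
  rw [Finset.sum_disjSum] at key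
  simp only [Sum.elim_inl, Sum.elim_inr, mul_neg, integral_neg, Finset.sum_neg_distrib] at key
  linear_combination key

/-- Polarization. -/
theorem inner_polarization {E M : Type*} [NormedAddCommGroup E] [InnerProductSpace ℂ E]
    [AddCommGroup M] [Module ℂ M] (f g : M →ₗ[ℂ] E) (v w : M) :
    inner ℂ (g w) (f v) = 4⁻¹ * ∑ k ∈ Finset.range 4,
      Complex.I ^ k * inner ℂ (g (v + Complex.I ^ k • w)) (f (v + Complex.I ^ k • w)) := by
  simp only [Finset.sum_range_succ, Finset.sum_range_zero, map_add, map_smul, inner_add_left,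
    inner_add_right, inner_smul_left, inner_smul_right, map_pow, Complex.conj_I]
  simp only [Complex.I_pow_three, Complex.I_sq, pow_zero, pow_one, neg_pow Complex.I]
  ring_nf
  simp only [Complex.I_sq]
  ring_nf

/-! ### Spectral calculus for the complex measures `(E(·)v, w)`. -/

namespace SpectralMeasure

variable {E : Type*} [NormedAddCommGroup E] [InnerProductSpace ℂ E] [CompleteSpace E]

theorem diag_univ (P : SpectralMeasure E) (v : E) :
    P.diag v univ = ENNReal.ofReal (‖v‖ ^ 2) := by
  rw [P.diag_apply v MeasurableSet.univ, P.proj_univ]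
  rfl

instance (P : SpectralMeasure E) (v : E) : IsFiniteMeasure (P.diag v) :=
  ⟨by rw [P.diag_univ]; exact ENNReal.ofReal_lt_top⟩

theorem diag_real (P : SpectralMeasure E) (v : E) {B : Set ℝ} (hB : MeasurableSet B) :
    (P.diag v).real B = ‖P.proj B v‖ ^ 2 := by
  rw [Measure.real, P.diag_apply v hB, ENNReal.toReal_ofReal (by positivity)]

theorem inner_self_proj (P : SpectralMeasure E) (v : E) {B : Set ℝ} (hB : MeasurableSet B) :
    inner ℂ v (P.proj B v) = ((P.diag v).real B : ℂ) := by
  have h1 : P.proj B v = P.proj B (P.proj B v) := by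
    conv_lhs => rw [← inter_self B, P.proj_inter B B hB hB]
    rfl
  rw [P.diag_real v hB, h1, ← ContinuousLinearMap.adjoint_inner_left,
    (P.isSelfAdjoint B hB).adjoint_eq, ← h1, inner_self_eq_norm_sq_to_K]
  norm_cast

theorem inner_proj_comm (P : SpectralMeasure E) {B : Set ℝ} (hB : MeasurableSet B) (v w : E) :
    inner ℂ (P.proj B v) w = inner ℂ v (P.proj B w) := by
  rw [← ContinuousLinearMap.adjoint_inner_left, (P.isSelfAdjoint B hB).adjoint_eq]

theorem integral_indicator_one (P : SpectralMeasure E) {B : Set ℝ} (hB : MeasurableSet B)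
    (v w : E) : P.integral (B.indicator fun _ => 1) v w = inner ℂ w (P.proj B v) := by
  rw [integral]
  have := inner_polarization (P.proj B).toLinearMap LinearMap.id v w
  simp only [LinearMap.id_apply, ContinuousLinearMap.coe_coe, P.inner_self_proj _ hB] at this
  rw [this]
  congr 1
  refine Finset.sum_congr rfl fun k _ => ?_
  rw [integral_indicator hB]
  simp

theorem integral_one (P : SpectralMeasure E) (v w : E) :
    P.integral (fun _ => 1) v w = inner ℂ w v := by
  have := P.integral_indicator_one MeasurableSet.univ v w
  rwa [indicator_univ, P.proj_univ] at this

theorem diag_smul_of_norm_eq_one (P : SpectralMeasure E) (v : E) {c : ℂ} (hc : ‖c‖ = 1) :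
    P.diag (c • v) = P.diag v := by
  ext B hB
  rw [P.diag_apply _ hB, P.diag_apply _ hB, map_smul, norm_smul, hc, one_mul]

/-- For unimodular `c`, the vectors `v + c w` and `w + c⁻¹ v` differ by a unimodular factor, so they
have the same diagonal measure; conjugation exchanges `I` and `-I` in the polarization sum. -/
theorem integral_conj (P : SpectralMeasure E) (g : ℝ → ℂ) (v w : E) :
    starRingEnd ℂ (P.integral g v w) = P.integral (fun x => starRingEnd ℂ (g x)) w v := by
  have e : ∀ c d : ℂ, c * d = 1 → ‖c‖ = 1 → P.diag (v + c • w) = P.diag (w + d • v) := by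
    intro c d hcd hc
    rw [← P.diag_smul_of_norm_eq_one (w + d • v) hc, smul_add, smul_smul, hcd, one_smul, add_comm]
  have h3 : Complex.I ^ 3 = -Complex.I := Complex.I_pow_three
  simp only [integral, Finset.sum_range_succ, Finset.sum_range_zero, map_mul, map_add, map_inv₀,
    _root_.integral_conj, map_zero, Complex.conj_I, h3, Complex.I_sq, pow_zero, pow_one]
  rw [e 1 1 (by simp) (by simp), e Complex.I (-Complex.I) (by simp) (by simp),
    e (-1) (-1) (by simp) (by simp), e (-Complex.I) Complex.I (by simp) (by simp)]
  simp only [map_ofNat, map_neg, map_one, Complex.conj_I]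
  ring

/-- On `B` the projection is invisible, and off `B` only `c w` survives, whose phase does not affect
the measure. -/
theorem diag_proj_add (P : SpectralMeasure E) {B : Set ℝ} (hB : MeasurableSet B) (v w : E)
    {c : ℂ} (hc : ‖c‖ = 1) : P.diag (P.proj B v + c • w) =
      (P.diag (v + c • w)).restrict B + (P.diag w).restrict Bᶜ := by
  ext A hA
  have h1 : P.proj (A ∩ B) (P.proj B v) = P.proj (A ∩ B) v := by
    rw [← ContinuousLinearMap.comp_apply, ← P.proj_inter _ _ (hA.inter hB) hB, inter_assoc,
      inter_self]
  have h2 : P.proj (A \ B) (P.proj B v) = 0 := by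
    rw [← ContinuousLinearMap.comp_apply, ← P.proj_inter _ _ (hA.diff hB) hB,
      sdiff_inter_self, P.proj_empty]
    rfl
  rw [← measure_inter_add_sdiff A hB, Measure.add_apply, Measure.restrict_apply hA,
    Measure.restrict_apply hA, ← sdiff_eq, P.diag_apply _ (hA.inter hB),
    P.diag_apply _ (hA.inter hB), P.diag_apply _ (hA.diff hB), P.diag_apply _ (hA.diff hB),
    map_add, map_add, map_add, h1, h2, zero_add, map_smul (P.proj (A \ B)), norm_smul, hc, one_mul]

theorem diag_zero (P : SpectralMeasure E) : P.diag 0 = 0 := by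
  ext A hA
  simp [P.diag_apply _ hA]

theorem diag_proj (P : SpectralMeasure E) {B : Set ℝ} (hB : MeasurableSet B) (v : E) :
    P.diag (P.proj B v) = (P.diag v).restrict B := by
  have := P.diag_proj_add hB v 0 (c := 1) (by simp)
  simpa [P.diag_zero] using this

theorem integrableOn_of_continuous {μ : Measure ℝ} [IsFiniteMeasure μ] {F : Type*}
    [NormedAddCommGroup F] [SecondCountableTopologyEither ℝ F] {f : ℝ → F}
    (hf : Continuous f) {a b : ℝ} {B : Set ℝ} (hB : B ⊆ Icc a b) :
    IntegrableOn f B μ :=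
  (hf.continuousOn.integrableOn_compact isCompact_Icc).mono_set hB

/-- `(E(B) v, H w) = ∫_B ω d(E(ω) v, w)` for bounded `B` and `w ∈ D(H)`. -/
theorem inner_apply_proj (P : SpectralMeasure E) {H : E →ₗ.[ℂ] E} (hs : IsSelfAdjoint H)
    (hP : P.IsSpectralMeasureOf H) {B : Set ℝ} (hB : MeasurableSet B) {a b : ℝ}
    (hab : B ⊆ Icc a b) (v : E) (w : H.domain) :
    inner ℂ (H w) (P.proj B v) = P.integral (B.indicator fun ω => (ω : ℂ)) v w := by
  have hu : P.proj B v ∈ H.domain := by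
    rw [hP.1, P.diag_proj hB]
    exact integrableOn_of_continuous (by fun_prop) hab
  have hsym : inner ℂ (H w) (P.proj B v) = inner ℂ (w : E) (H ⟨_, hu⟩) := by
    have h := LinearPMap.adjoint_isFormalAdjoint hs.dense_domain
    rw [LinearPMap.isSelfAdjoint_def.1 hs] at h
    exact h w ⟨_, hu⟩
  have hpol := inner_polarization H.toFun H.domain.subtype ⟨_, hu⟩ w
  simp only [LinearPMap.toFun_eq_coe, Submodule.subtype_apply, hP.2] at hpol
  rw [hsym, hpol, integral]
  -- The measure is finite and `|ω| ≤ ω² + 1`.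
  have hw : ∀ x : H.domain, Integrable (fun ω : ℝ => ω) (P.diag (x : E)) := by
    intro x
    have h2 := (hP.1 x).1 x.2
    refine (h2.add (integrable_const (1 : ℝ))).mono' (by fun_prop) (ae_of_all _ fun ω => ?_)
    rw [Real.norm_eq_abs, abs_le]
    simp only [Pi.add_apply]
    constructor <;> nlinarith [sq_nonneg (ω + 1), sq_nonneg (ω - 1)]
  have key : ∀ k : ℕ, ((∫ ω, ω ∂(P.diag (((⟨P.proj B v, hu⟩ : H.domain) +
      Complex.I ^ k • w : H.domain) : E)) : ℝ) : ℂ) =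
      (∫ ω, B.indicator (fun ω : ℝ => (ω : ℂ)) ω ∂(P.diag (v + Complex.I ^ k • (w : E)))) +
      ((∫ ω in Bᶜ, ω ∂(P.diag (w : E)) : ℝ) : ℂ) := by
    intro k
    have : P.diag (((⟨P.proj B v, hu⟩ : H.domain) + Complex.I ^ k • w : H.domain) : E) =
        (P.diag (v + Complex.I ^ k • (w : E))).restrict B + (P.diag (w : E)).restrict Bᶜ :=
      P.diag_proj_add hB v w (by simp)
    rw [this, integral_add_measure (integrableOn_of_continuous (by fun_prop) hab)
      (hw w).integrableOn, integral_indicator hB]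
    push_cast
    congr 1
    exact integral_ofReal.symm
  -- The contribution of `Bᶜ` is the same for all four `k`, and `1 + I + I² + I³ = 0` removes it.
  simp only [key, mul_add, Finset.sum_add_distrib]
  simp only [Finset.sum_range_succ, Finset.sum_range_zero, Complex.I_pow_three, Complex.I_sq,
    pow_zero, pow_one]
  ring

/-- `(E(B) H v, w) = ∫_B ω d(E(ω) v, w)` for bounded `B` and `v ∈ D(H)`. -/
theorem inner_proj_apply (P : SpectralMeasure E) {H : E →ₗ.[ℂ] E} (hs : IsSelfAdjoint H)
    (hP : P.IsSpectralMeasureOf H) {B : Set ℝ} (hB : MeasurableSet B) {a b : ℝ}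
    (hab : B ⊆ Icc a b) (v : H.domain) (w : E) :
    inner ℂ w (P.proj B (H v)) = P.integral (B.indicator fun ω => (ω : ℂ)) v w := by
  rw [← P.inner_proj_comm hB, ← inner_conj_symm, P.inner_apply_proj hs hP hB hab, integral_conj]
  congr 1
  ext ω
  by_cases h : ω ∈ B <;> simp [h]

/-- `(E(B) (l - H) v, w) = ∫_B (l - ω) d(E(ω) v, w)` for bounded `B` and `v ∈ D(H)`. -/
theorem inner_proj_smul_sub (P : SpectralMeasure E) {H : E →ₗ.[ℂ] E} (hs : IsSelfAdjoint H)
    (hP : P.IsSpectralMeasureOf H) {B : Set ℝ} (hB : MeasurableSet B) {a b : ℝ}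
    (hab : B ⊆ Icc a b) (l : ℂ) (v : H.domain) (w : E) :
    inner ℂ w (P.proj B (l • (v : E) - H v)) =
      P.integral (B.indicator fun ω => l - ω) v w := by
  rw [map_sub, map_smul, inner_sub_right, inner_smul_right, P.inner_proj_apply hs hP hB hab,
    ← P.integral_indicator_one hB]
  simp only [integral, Finset.mul_sum, ← Finset.sum_sub_distrib]
  refine Finset.sum_congr rfl fun k _ => ?_
  rw [integral_indicator hB, integral_indicator hB, integral_indicator hB, integral_sub
    (integrableOn_of_continuous (by fun_prop) hab) (integrableOn_of_continuous (by fun_prop) hab),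
    ← mul_one l, integral_const_mul]
  ring

/-- If `(E(B) v₁, w₁) = ∫_B p d(E(ω) v₂, w₂)` for bounded `B`, then
`∫ g d(E(ω) v₁, w₁) = ∫ g p d(E(ω) v₂, w₂)`. -/
theorem integral_eq_integral_mul (P : SpectralMeasure E) {p : ℝ → ℂ} (hp : Continuous p)
    {v₁ w₁ v₂ w₂ : E}
    (h : ∀ n : ℕ, ∀ B ⊆ Icc (-n : ℝ) n, MeasurableSet B →
      inner ℂ w₁ (P.proj B v₁) = P.integral (B.indicator p) v₂ w₂)
    {g : ℝ → ℂ} (hg : Measurable g) {C C' : ℝ} (hC : ∀ x, ‖g x‖ ≤ C)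
    (hC' : ∀ x, ‖g x * p x‖ ≤ C') :
    P.integral g v₁ w₁ = P.integral (fun x => g x * p x) v₂ w₂ := by
  -- The weight `p` may be unbounded and only `g p` is controlled, so the identity is proved on
  -- `[-n, n]` first and passes to the limit by dominated convergence.
  have hn : ∀ n : ℕ, P.integral ((Icc (-n : ℝ) n).indicator g) v₁ w₁ =
      P.integral ((Icc (-n : ℝ) n).indicator fun x => g x * p x) v₂ w₂ := by
    intro n
    have := sum_integral_mul_eq_sum (Finset.range 4) (Finset.range 4)
      (fun k => (P.diag (v₁ + Complex.I ^ k • w₁)).restrict (Icc (-n : ℝ) n))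
      (fun k => (P.diag (v₂ + Complex.I ^ k • w₂)).restrict (Icc (-n : ℝ) n))
      (fun k _ => 4⁻¹ * Complex.I ^ k) (fun k x => 4⁻¹ * Complex.I ^ k * p x)
      (fun k _ => integrable_const _)
      (fun k _ => (integrableOn_of_continuous (by fun_prop) subset_rfl)) (by
        intro B hB
        have := h n (B ∩ Icc (-n : ℝ) n) inter_subset_right (hB.inter measurableSet_Icc)
        rw [← P.integral_indicator_one (hB.inter measurableSet_Icc), integral, integral,
          Finset.mul_sum, Finset.mul_sum] at this
        refine Eq.trans (Finset.sum_congr rfl fun k _ => ?_)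
          (this.trans (Finset.sum_congr rfl fun k _ => ?_))
        · rw [integral_indicator (hB.inter measurableSet_Icc), Measure.restrict_restrict hB,
            ← mul_one (4⁻¹ * Complex.I ^ k), integral_const_mul, mul_assoc]
        · rw [integral_indicator (hB.inter measurableSet_Icc), Measure.restrict_restrict hB,
            integral_const_mul, mul_assoc])
      g hg C hC
    simp only [integral, Finset.mul_sum]
    refine Eq.trans (Finset.sum_congr rfl fun k _ => ?_)
      (this.trans (Finset.sum_congr rfl fun k _ => ?_))
    · rw [integral_indicator measurableSet_Icc, ← mul_assoc, ← integral_const_mul]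
      exact integral_congr_ae (ae_of_all _ fun x => mul_comm _ _)
    · rw [integral_indicator measurableSet_Icc, ← mul_assoc, ← integral_const_mul]
      refine integral_congr_ae (ae_of_all _ fun x => ?_)
      simp only
      ring
  have lim : ∀ (f : ℝ → ℂ) (D : ℝ), Measurable f → (∀ x, ‖f x‖ ≤ D) → ∀ v w,
      Tendsto (fun n : ℕ => P.integral ((Icc (-n : ℝ) n).indicator f) v w) atTop
        (𝓝 (P.integral f v w)) := by
    intro f D hf hD v w
    unfold integral
    refine Tendsto.const_mul _ (tendsto_finsetSum _ fun k _ => Tendsto.const_mul _ ?_)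
    refine tendsto_integral_of_dominated_convergence (fun _ => D)
      (fun n => (hf.indicator measurableSet_Icc).aestronglyMeasurable) (integrable_const _)
      (fun n => ae_of_all _ fun x => (norm_indicator_le_norm_self _ _).trans (hD x))
      (ae_of_all _ fun x => ?_)
    obtain ⟨N, hN⟩ := exists_nat_ge |x|
    refine tendsto_const_nhds.congr' ?_
    filter_upwards [eventually_ge_atTop N] with n hn
    have hx : |x| ≤ n := hN.trans (by exact_mod_cast hn)
    exact (indicator_of_mem (mem_Icc.2 (abs_le.1 hx)) f).symm
  refine tendsto_nhds_unique (lim g C hg hC v₁ w₁) ?_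
  simp only [hn]
  exact lim _ C' (hg.mul hp.measurable) hC' v₂ w₂

end SpectralMeasure

namespace SpectralMeasure

variable {E : Type*} [NormedAddCommGroup E] [InnerProductSpace ℂ E] [CompleteSpace E]

theorem integral_const_mul_add (P : SpectralMeasure E) {g : ℝ → ℂ} (hg : Measurable g) {C : ℝ}
    (hC : ∀ x, ‖g x‖ ≤ C) (c d : ℂ) (v w : E) :
    P.integral (fun x => c * g x + d) v w = c * P.integral g v w + d * inner ℂ w v := by
  rw [← P.integral_one v w]
  simp only [integral, Finset.mul_sum, ← Finset.sum_add_distrib]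
  refine Finset.sum_congr rfl fun k _ => ?_
  have hi : Integrable g (P.diag (v + Complex.I ^ k • w)) :=
    Integrable.of_bound hg.aestronglyMeasurable C (ae_of_all _ hC)
  have hd : ∫ _ : ℝ, d ∂(P.diag (v + Complex.I ^ k • w)) =
      d * ∫ _ : ℝ, (1 : ℂ) ∂(P.diag (v + Complex.I ^ k • w)) := by
    rw [← integral_const_mul, mul_one]
  rw [integral_add (hi.const_mul c) (integrable_const d), integral_const_mul, hd]
  ring

end SpectralMeasure

theorem abs_im_le_norm_sub_ofReal (z : ℂ) (ω : ℝ) : |z.im| ≤ ‖z - ω‖ := by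
  simpa using Complex.abs_im_le_norm (z - ω)

theorem norm_inv_sub_le {z : ℂ} (hz : z.im ≠ 0) (ω : ℝ) : ‖(z - ω)⁻¹‖ ≤ |z.im|⁻¹ := by
  rw [norm_inv]
  exact inv_anti₀ (abs_pos.2 hz) (abs_im_le_norm_sub_ofReal z ω)

theorem sub_ofReal_ne_zero {z : ℂ} (hz : z.im ≠ 0) (ω : ℝ) : z - ω ≠ 0 :=
  norm_pos_iff.1 ((abs_pos.2 hz).trans_le (abs_im_le_norm_sub_ofReal z ω))

/-! ### Analytic continuation of the spectral forms and the resolvent identities for `A(λ)`. -/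

namespace Data

variable {E X : Type*} [NormedAddCommGroup E] [InnerProductSpace ℂ E] [CompleteSpace E]
  [AddCommGroup X] [Module ℂ X] [TopologicalSpace X] {D : Data E X}

theorem measurable_inv_sub (z : ℂ) : Measurable fun ω : ℝ => (z - ω)⁻¹ :=
  (measurable_const.sub Complex.measurable_ofReal).inv

namespace Assumptions

/-- The set lies between the connected set `Ω` and its closure. -/
theorem isPreconnected (hD : D.Assumptions) : IsPreconnected (D.Ω ∪ D.intervalC) := by
  have := hD.simplyConnected_Ω
  have hc : IsPreconnected D.Ω := isPreconnected_iff_preconnectedSpace.2 inferInstance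
  refine hc.subset_closure subset_union_left (union_subset subset_closure ?_)
  rintro _ ⟨x, hx, rfl⟩
  exact interior_subset (s := D.closedInterval) hx

theorem continuousOn_density (hD : D.Assumptions) (φ : X) :
    ContinuousOn (fun ω : ℝ => D.density φ ω) D.interval :=
  (hD.analytic φ).continuousOn.comp Complex.continuous_ofReal.continuousOn
    fun x hx => Or.inr ⟨x, hx, rfl⟩

theorem diag_real_eq (hD : D.Assumptions) (φ : X) {B : Set ℝ} (hB : MeasurableSet B)
    (h : B ⊆ D.interval) :
    ((D.spec.diag (D.incl φ)).real B : ℂ) = ∫ ω in B, D.density φ (ω : ℂ) := by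
  rw [← D.spec.inner_self_proj _ hB, hD.density_eq φ B h hB]

/-- The measure `(E(·)φ, φ)` has the density `E[φ, φ]` on compact subintervals of `I`. -/
theorem setIntegral_diag (hD : D.Assumptions) (φ : X) {a b : ℝ} (hab : Icc a b ⊆ D.interval)
    {B : Set ℝ} (hB : MeasurableSet B) (h : B ⊆ Icc a b) {p : ℝ → ℂ} (hp : Continuous p) :
    ∫ ω in B, p ω ∂(D.spec.diag (D.incl φ)) = ∫ ω in B, p ω * D.density φ ω := by
  obtain ⟨C, hC⟩ := (isCompact_Icc (a := a) (b := b)).exists_bound_of_continuousOn hp.continuousOn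
  have := sum_integral_mul_eq_sum {()} {()}
    (fun _ => (D.spec.diag (D.incl φ)).restrict (Icc a b)) (fun _ => volume.restrict (Icc a b))
    (fun _ _ => 1) (fun _ ω => D.density φ ω) (fun _ _ => integrable_const _)
    (fun _ _ => ((hD.continuousOn_density φ).mono hab).integrableOn_compact isCompact_Icc) (by
      intro A hA
      simp only [Finset.sum_singleton, Measure.restrict_restrict hA]
      rw [← hD.diag_real_eq φ (hA.inter measurableSet_Icc) (inter_subset_right.trans hab)]
      simp)
    (B.indicator p) (hp.measurable.indicator hB) (max C 0) (by
      intro x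
      by_cases hx : x ∈ B
      · rw [indicator_of_mem hx]
        exact (hC x (h hx)).trans (le_max_left _ _)
      · simp [indicator_of_notMem hx])
  have e : (fun ω : ℝ => B.indicator p ω * D.density φ ω) =
      B.indicator fun ω => p ω * D.density φ ω := by
    ext ω
    rw [indicator_mul_left]
  simp only [Finset.sum_singleton, mul_one] at this
  rwa [e, integral_indicator hB, integral_indicator hB, Measure.restrict_restrict hB,
    Measure.restrict_restrict hB, inter_eq_left.2 h] at this

theorem form_analytic (hD : D.Assumptions) (ψ φ : X) :
    AnalyticOnNhd ℂ (D.form ψ φ) (D.Ω ∪ D.intervalC) := by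
  intro z hz
  unfold form
  refine analyticAt_const.mul (Finset.analyticAt_fun_sum _ fun k _ => ?_)
  exact analyticAt_const.mul (hD.analytic _ z hz)

/-- A multiplicative relation between spectral forms continues analytically to `Ω ∪ I`. -/
theorem form_eq_mul_form (hD : D.Assumptions) {p : ℂ → ℂ} (hp : Differentiable ℂ p)
    {ψ₁ φ₁ ψ₂ φ₂ : X}
    (h : ∀ n : ℕ, ∀ B ⊆ Icc (-n : ℝ) n, MeasurableSet B →
      inner ℂ (D.incl φ₁) (D.spec.proj B (D.incl ψ₁)) =
        D.spec.integral (B.indicator fun ω => p ω) (D.incl ψ₂) (D.incl φ₂))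
    {z : ℂ} (hz : z ∈ D.Ω ∪ D.intervalC) :
    D.form ψ₁ φ₁ z = p z * D.form ψ₂ φ₂ z := by
  -- The plan: the set identity gives equality almost everywhere on a compact interval inside `I`,
  -- continuity gives it everywhere there, and the identity theorem carries it to the connected set
  -- `Ω ∪ I`.
  obtain ⟨x, hx⟩ := hD.nonempty_interval
  obtain ⟨ε, hε, hball⟩ := Metric.nhds_basis_closedBall.mem_iff.1 (isOpen_interior.mem_nhds hx)
  rw [Real.closedBall_eq_Icc] at hball
  have hJ : Icc (x - ε) (x + ε) ⊆ D.interval := hball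
  have hpc : Continuous fun ω : ℝ => p ω := hp.continuous.comp Complex.continuous_ofReal
  obtain ⟨n, hn⟩ := exists_nat_ge (|x| + ε)
  have hJn : Icc (x - ε) (x + ε) ⊆ Icc (-n : ℝ) n := by
    refine Icc_subset_Icc ?_ ?_
    · linarith [neg_abs_le x]
    · linarith [le_abs_self x]
  have hci : ∀ ψ φ : X, ContinuousOn (fun ω : ℝ => D.form ψ φ ω) (Icc (x - ε) (x + ε)) :=
    fun ψ φ => ((hD.form_analytic ψ φ).continuousOn.comp Complex.continuous_ofReal.continuousOn
      fun y hy => Or.inr ⟨y, hy, rfl⟩).mono hJ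
  have hform : ∀ (ψ φ : X) (q : ℝ → ℂ), Continuous q → ∀ B ⊆ Icc (x - ε) (x + ε),
      MeasurableSet B → D.spec.integral (B.indicator q) (D.incl ψ) (D.incl φ) =
        ∫ ω in B, q ω * D.form ψ φ ω := by
    intro ψ φ q hq B hBJ hB
    have hint : ∀ k ∈ Finset.range 4, IntegrableOn
        (fun ω : ℝ => 4⁻¹ * (Complex.I ^ k * (q ω * D.density (ψ + Complex.I ^ k • φ) ω))) B :=
      fun k _ => (((continuousOn_const.mul (continuousOn_const.mul (hq.continuousOn.mul
        ((hD.continuousOn_density _).mono hJ)))).integrableOn_compact isCompact_Icc).mono_set hBJ)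
    have e : ∀ ω : ℝ, q ω * D.form ψ φ ω = ∑ k ∈ Finset.range 4,
        4⁻¹ * (Complex.I ^ k * (q ω * D.density (ψ + Complex.I ^ k • φ) ω)) := by
      intro ω
      simp only [form, Finset.mul_sum]
      exact Finset.sum_congr rfl fun k _ => by ring
    simp only [e]
    rw [integral_finsetSum _ hint, SpectralMeasure.integral, Finset.mul_sum]
    refine Finset.sum_congr rfl fun k _ => ?_
    rw [integral_const_mul, integral_const_mul, integral_indicator hB, ← map_smul, ← map_add,
      hD.setIntegral_diag _ hJ hB hBJ hq]
  have hae : (fun ω : ℝ => D.form ψ₁ φ₁ ω - p ω * D.form ψ₂ φ₂ ω)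
      =ᵐ[volume.restrict (Icc (x - ε) (x + ε))] fun _ => 0 := by
    have hi₁ := (hci ψ₁ φ₁).integrableOn_compact isCompact_Icc (μ := volume)
    have hi₂ : IntegrableOn (fun ω : ℝ => p ω * D.form ψ₂ φ₂ ω) (Icc (x - ε) (x + ε)) := (hpc.continuousOn.mul (hci ψ₂ φ₂)).integrableOn_compact isCompact_Icc
    refine Integrable.ae_eq_zero_of_forall_setIntegral_eq_zero (hi₁.sub hi₂) ?_
    intro B hB _
    rw [Measure.restrict_restrict hB, integral_sub (hi₁.mono_set inter_subset_right)
      (hi₂.mono_set inter_subset_right)]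
    have hBm := hB.inter (measurableSet_Icc (a := x - ε) (b := x + ε))
    have h1 := h n _ (inter_subset_right.trans hJn) hBm
    rw [← D.spec.integral_indicator_one hBm, hform _ _ _ continuous_const _ inter_subset_right hBm,
      hform _ _ _ hpc _ inter_subset_right hBm] at h1
    simpa [sub_eq_zero] using h1
  have hzero : EqOn (fun ω : ℝ => D.form ψ₁ φ₁ ω - p ω * D.form ψ₂ φ₂ ω) (fun _ => 0)
      (Icc (x - ε) (x + ε)) :=
    Measure.eqOn_Icc_of_ae_eq volume (by linarith) hae
      ((hci ψ₁ φ₁).sub (hpc.continuousOn.mul (hci ψ₂ φ₂))) continuousOn_const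
  have han : AnalyticOnNhd ℂ (fun z => D.form ψ₁ φ₁ z - p z * D.form ψ₂ φ₂ z)
      (D.Ω ∪ D.intervalC) := fun w hw =>
    (hD.form_analytic ψ₁ φ₁ w hw).sub ((hp.analyticAt w).mul (hD.form_analytic ψ₂ φ₂ w hw))
  have hfreq : ∃ᶠ w in 𝓝[≠] (x : ℂ), D.form ψ₁ φ₁ w - p w * D.form ψ₂ φ₂ w = 0 := by
    have ht : Tendsto (fun y : ℝ => (y : ℂ)) (𝓝[≠] x) (𝓝[≠] (x : ℂ)) :=
      tendsto_nhdsWithin_of_tendsto_nhds_of_eventually_within _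
        (Complex.continuous_ofReal.continuousAt.tendsto.mono_left nhdsWithin_le_nhds)
        (by filter_upwards [self_mem_nhdsWithin] with y hy
            exact fun h => hy (Complex.ofReal_injective h))
    refine ht.frequently (Eventually.frequently ?_)
    filter_upwards [nhdsWithin_le_nhds (Icc_mem_nhds (a := x - ε) (b := x + ε)
      (by linarith) (by linarith))] with y hy
    exact hzero hy
  exact sub_eq_zero.1 (han.eqOn_zero_of_preconnected_of_frequently_eq_zero hD.isPreconnected
    (Or.inr ⟨x, hx, rfl⟩) hfreq hz)

end Assumptions

theorem norm_inv_sub_mul_sub_le {z l : ℂ} (hz : z.im ≠ 0) (ω : ℝ) :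
    ‖(z - ω)⁻¹ * (l - ω)‖ ≤ 1 + ‖l - z‖ * |z.im|⁻¹ := by
  have h : (z - ω)⁻¹ * (l - ω) = 1 + (l - z) * (z - ω)⁻¹ := by
    field_simp [sub_ofReal_ne_zero hz ω]
    ring
  rw [h]
  refine (norm_add_le _ _).trans ?_
  rw [norm_one, norm_mul]
  gcongr
  exact norm_inv_sub_le hz ω

/-- This is `ω/(z - ω) = z/(z - ω) - 1` integrated against the spectral measure; boundedness of the
left side for non-real `z` makes `integral_eq_integral_mul` applicable. -/
theorem cauchy_right (hD : D.Assumptions) {z : ℂ} (hz : z.im ≠ 0) (ψ : X) {p : X × X}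
    (hp : p ∈ D.partGraph D.H) :
    D.cauchy z ψ p.2 = z * D.cauchy z ψ p.1 - D.embed ψ p.1 := by
  obtain ⟨hdom, hp⟩ := hp
  have e : ∀ ω : ℝ, (z - ω)⁻¹ * ω = z * (z - ω)⁻¹ + -1 := by
    intro ω
    field_simp [sub_ofReal_ne_zero hz ω]
    ring
  have hb : ∀ ω : ℝ, ‖(z - ω)⁻¹ * ω‖ ≤ 1 + ‖0 - z‖ * |z.im|⁻¹ := by
    intro ω
    simpa using norm_inv_sub_mul_sub_le (l := 0) hz ω
  have := D.spec.integral_eq_integral_mul (p := fun ω => (ω : ℂ)) (by fun_prop)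
    (v₁ := D.incl ψ) (w₁ := D.incl p.2) (v₂ := D.incl ψ) (w₂ := D.incl p.1) (by
      intro n B hB hBm
      rw [← hp]
      exact D.spec.inner_apply_proj hD.selfAdjoint hD.spectral hBm hB _ ⟨_, hdom⟩)
    (measurable_inv_sub z) (norm_inv_sub_le hz) hb
  rw [cauchy, this]
  simp only [e]
  rw [D.spec.integral_const_mul_add (measurable_inv_sub z) (norm_inv_sub_le hz), cauchy,
    embed_apply]
  ring

/-- This is `(l - ω)/(z - ω) = (l - z)/(z - ω) + 1`. The two parameters are kept apart because for
real `l` the point `z` only tends to `l`. -/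
theorem cauchy_left (hD : D.Assumptions) {z : ℂ} (hz : z.im ≠ 0) (l : ℂ) (φ : X) {p : X × X}
    (hp : p ∈ D.partGraph D.H) :
    D.cauchy z (l • p.1 - p.2) φ = (l - z) * D.cauchy z p.1 φ + D.embed p.1 φ := by
  obtain ⟨hdom, hp⟩ := hp
  have e : ∀ ω : ℝ, (z - ω)⁻¹ * (l - ω) = (l - z) * (z - ω)⁻¹ + 1 := by
    intro ω
    field_simp [sub_ofReal_ne_zero hz ω]
    ring
  have := D.spec.integral_eq_integral_mul (p := fun ω => l - (ω : ℂ)) (by fun_prop)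
    (v₁ := D.incl (l • p.1 - p.2)) (w₁ := D.incl φ) (v₂ := D.incl p.1) (w₂ := D.incl φ) (by
      intro n B hB hBm
      rw [map_sub, map_smul, ← hp]
      exact D.spec.inner_proj_smul_sub hD.selfAdjoint hD.spectral hBm hB l ⟨_, hdom⟩ _)
    (measurable_inv_sub z) (norm_inv_sub_le hz) (norm_inv_sub_mul_sub_le hz)
  rw [cauchy, this]
  simp only [e]
  rw [D.spec.integral_const_mul_add (measurable_inv_sub z) (norm_inv_sub_le hz), cauchy,
    embed_apply]
  ring

/-- The spectral measure has no atoms in `I`. -/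
theorem tendsto_mul_cauchy (hD : D.Assumptions) {x : ℝ} (hx : x ∈ D.interval) (ψ φ : X) :
    Tendsto (fun y : ℝ => y * Complex.I * D.cauchy (x + y * Complex.I) ψ φ) (𝓝[<] 0) (𝓝 0) := by
  have key : ∀ χ : X, Tendsto (fun y : ℝ => ∫ ω : ℝ,
      y * Complex.I * (x + y * Complex.I - ω)⁻¹ ∂(D.spec.diag (D.incl χ))) (𝓝[<] 0) (𝓝 0) := by
    intro χ
    -- At `ω = x` the integrand is identically `1`, so convergence to `0` fails exactly there; a
    -- measure with a density on `I` does not see this point.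
    have hz : D.spec.diag (D.incl χ) {x} = 0 := by
      have := hD.diag_real_eq χ (measurableSet_singleton x) (singleton_subset_iff.2 hx)
      rw [Measure.restrict_singleton] at this
      simpa [measureReal_eq_zero_iff] using this
    rw [show (0 : ℂ) = ∫ ω : ℝ, (0 : ℂ) ∂(D.spec.diag (D.incl χ)) by simp]
    refine tendsto_integral_filter_of_dominated_convergence (fun _ => 1) ?_ ?_
      (integrable_const _) ?_
    · exact Eventually.of_forall fun y =>
        (measurable_const.mul (measurable_inv_sub _)).aestronglyMeasurable
    · filter_upwards [self_mem_nhdsWithin] with y hy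
      refine ae_of_all _ fun ω => ?_
      have him : (x + y * Complex.I : ℂ).im = y := by simp
      have hy0 : |y| ≠ 0 := abs_ne_zero.2 (ne_of_lt hy)
      have := norm_inv_sub_le (z := x + y * Complex.I) (by rw [him]; exact ne_of_lt hy) ω
      rw [him] at this
      rw [norm_mul, norm_mul, Complex.norm_I, Complex.norm_real, Real.norm_eq_abs, mul_one]
      calc |y| * _ ≤ |y| * |y|⁻¹ := by gcongr
        _ = 1 := mul_inv_cancel₀ hy0
    · have : ∀ᵐ ω ∂(D.spec.diag (D.incl χ)), ω ≠ x := by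
        rw [ae_iff]
        simpa using hz
      filter_upwards [this] with ω hω
      have hc : ContinuousAt (fun y : ℝ => y * Complex.I * ((x : ℂ) + y * Complex.I - ω)⁻¹) 0 := by
        refine ContinuousAt.mul (by fun_prop) (ContinuousAt.inv₀ (by fun_prop) ?_)
        simpa [sub_eq_zero] using Ne.symm hω
      have := hc.tendsto.mono_left (nhdsWithin_le_nhds (s := Iio 0))
      simpa using this
  have hs : Tendsto (fun y : ℝ => 4⁻¹ * ∑ k ∈ Finset.range 4, Complex.I ^ k * ∫ ω : ℝ,
      y * Complex.I * (x + y * Complex.I - ω)⁻¹ ∂(D.spec.diag (D.incl (ψ + Complex.I ^ k • φ))))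
      (𝓝[<] 0) (𝓝 (4⁻¹ * ∑ k ∈ Finset.range 4, Complex.I ^ k * 0)) :=
    Tendsto.const_mul _ (tendsto_finsetSum _ fun k _ => Tendsto.const_mul _ (key _))
  simp only [mul_zero, Finset.sum_const_zero] at hs
  refine hs.congr fun y => ?_
  rw [cauchy, SpectralMeasure.integral]
  simp only [integral_const_mul, Finset.mul_sum, map_add, map_smul]
  exact Finset.sum_congr rfl fun k _ => by ring

/-- `A(λ) iψ` satisfies `(λ - H^×) A(λ) iψ = iψ`. -/
theorem IsA.apply_part (hD : D.Assumptions) {l : ℂ} (hl : l ∈ D.extDomain) {ψ : X}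
    {μ : AntiDual X} (h : D.IsA l ψ μ) {p : X × X} (hp : p ∈ D.partGraph D.H) :
    μ p.2 = l * μ p.1 - D.embed ψ p.1 := by
  rcases hl with (hl | hl) | hl
  -- In `Ω` the continued density term must satisfy the homogeneous relation by itself, since
  -- `cauchy_right` already yields all of `iψ`.
  · have hf : D.form ψ p.2 l = l * D.form ψ p.1 l := by
      obtain ⟨hdom, hp⟩ := hp
      refine hD.form_eq_mul_form (p := fun z => z) differentiable_id ?_ (Or.inl hl)
      intro n B hB hBm
      rw [← hp]
      exact D.spec.inner_apply_proj hD.selfAdjoint hD.spectral hBm hB _ ⟨_, hdom⟩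
    rw [h.upper hl, h.upper hl, hf, cauchy_right hD (hD.upper_Ω l hl).ne' ψ hp]
    ring
  · have h2 := h.real hl p.2
    have h1 := h.real hl p.1
    refine tendsto_nhds_unique h2 ?_
    have hz : Tendsto (fun y : ℝ => l + y * Complex.I) (𝓝[<] 0) (𝓝 l) := by
      have hc : Continuous fun y : ℝ => l + y * Complex.I := by fun_prop
      have := (hc.tendsto 0).mono_left (nhdsWithin_le_nhds (s := Iio 0))
      simpa using this
    refine ((hz.mul h1).sub_const _).congr' ?_
    filter_upwards [self_mem_nhdsWithin] with y hy
    obtain ⟨x, -, rfl⟩ := hl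
    exact (cauchy_right hD (by simpa using ne_of_lt hy) ψ hp).symm
  · rw [h.lower hl, h.lower hl, cauchy_right hD (ne_of_lt hl) ψ hp]

/-- `A(λ) i(λ - H)ψ = iψ` for `ψ` in the part of `H`. -/
theorem isA_smul_sub (hD : D.Assumptions) (l : ℂ) {p : X × X} (hp : p ∈ D.partGraph D.H) :
    D.IsA l (l • p.1 - p.2) (D.embed p.1) where
  upper hl φ := by
    -- The continued weight `l - z` vanishes at `z = l`, so the density term disappears.
    have hf : D.form (l • p.1 - p.2) φ l = (l - l) * D.form p.1 φ l := by
      obtain ⟨hdom, hp⟩ := hp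
      refine hD.form_eq_mul_form (p := fun z => l - z) (by fun_prop) ?_ (Or.inl hl)
      intro n B hB hBm
      rw [map_sub, map_smul, ← hp]
      exact D.spec.inner_proj_smul_sub hD.selfAdjoint hD.spectral hBm hB l ⟨_, hdom⟩ _
    rw [hf, cauchy_left hD (hD.upper_Ω l hl).ne' l φ hp]
    ring
  real hl φ := by
    obtain ⟨x, hx, rfl⟩ := hl
    -- Here `l - z = -y I`, so the remainder in `cauchy_left` is minus the quantity that tends to
    -- zero for lack of atoms.
    have := ((tendsto_mul_cauchy hD hx p.1 φ).neg).add_const (D.embed p.1 φ)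
    rw [neg_zero, zero_add] at this
    refine this.congr' ?_
    filter_upwards [self_mem_nhdsWithin] with y hy
    rw [cauchy_left hD (by simpa using ne_of_lt hy) _ φ hp]
    ring
  lower hl φ := by
    rw [cauchy_left hD (ne_of_lt hl) l φ hp]
    ring

end Data

/-! ### Riemann integrals in quasi-complete spaces -/

section Mean

variable {X : Type*} [AddCommGroup X] [Module ℂ X]

/-- The mean of `f` over the points `k / 2 ^ n` of `[0, 1)`. -/
def dyadicMean (f : ℝ → X) (n : ℕ) : X :=
  ∑ k ∈ Finset.range (2 ^ n), ((2 ^ n : ℝ)⁻¹) • f (k / 2 ^ n)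

theorem sum_range_mul_comp_div {M : Type*} [AddCommMonoid M] (g : ℕ → M) (a : ℕ) {b : ℕ}
    (hb : 0 < b) :
    ∑ k ∈ Finset.range (a * b), g (k / b) = b • ∑ i ∈ Finset.range a, g i := by
  induction a with
  | zero => simp
  | succ a ih =>
    rw [Nat.succ_mul, Finset.sum_range_add, ih, Finset.sum_range_succ, smul_add]
    congr 1
    rw [Finset.sum_congr rfl (g := fun _ => g a), Finset.sum_const, Finset.card_range]
    intro x hx
    rw [Nat.mul_comm, Nat.mul_add_div hb, Nat.div_eq_of_lt (Finset.mem_range.1 hx), add_zero]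

/-- Each coarse point is repeated `2 ^ j` times to match the finer grid; the inner `k / 2 ^ j` is
integer division and picks the coarse point to the left of the fine one. -/
theorem dyadicMean_add_sub (f : ℝ → X) (n j : ℕ) :
    dyadicMean f (n + j) - dyadicMean f n = ∑ k ∈ Finset.range (2 ^ (n + j)),
      ((2 ^ (n + j) : ℝ)⁻¹) • (f (k / 2 ^ (n + j)) - f ((k / 2 ^ j : ℕ) / 2 ^ n)) := by
  simp only [smul_sub, Finset.sum_sub_distrib]
  rw [dyadicMean, dyadicMean]
  congr 1
  rw [pow_add 2 n j, sum_range_mul_comp_div (fun i : ℕ => ((2 ^ (n + j) : ℝ)⁻¹) • f (i / 2 ^ n))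
    _ (by positivity), Finset.smul_sum]
  refine Finset.sum_congr rfl fun k _ => ?_
  rw [← Nat.cast_smul_eq_nsmul ℝ, smul_smul]
  congr 1
  push_cast
  rw [pow_add]
  field_simp

theorem div_two_pow_mem_Icc {n k : ℕ} (hk : k < 2 ^ n) : (k / 2 ^ n : ℝ) ∈ Icc (0 : ℝ) 1 := by
  refine ⟨by positivity, ?_⟩
  rw [div_le_one (by positivity)]
  exact_mod_cast hk.le

theorem sum_dyadic_mem {V : Set X} (hV : Convex ℝ V) (n : ℕ) (g : ℕ → X)
    (h : ∀ k < 2 ^ n, g k ∈ V) :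
    ∑ k ∈ Finset.range (2 ^ n), ((2 ^ n : ℝ)⁻¹) • g k ∈ V := by
  refine hV.sum_mem (fun _ _ => by positivity) ?_ fun k hk => h k (Finset.mem_range.1 hk)
  simp

variable [UniformSpace X] [IsUniformAddGroup X] [LocallyConvexSpace ℝ X]

/-- Two means differ by a convex combination of increments of `f` over distances at most `2⁻ᴺ`;
uniform continuity puts the increments in a convex neighborhood of zero, and the combination stays
there. -/
theorem cauchySeq_dyadicMean {f : ℝ → X} (hf : ContinuousOn f (Icc 0 1)) :
    CauchySeq (dyadicMean f) := by
  rw [(uniformity X).basis_sets.cauchySeq_iff']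
  intro W hW
  rw [uniformity_eq_comap_nhds_zero] at hW
  obtain ⟨V₀, hV₀, hVW⟩ := hW
  obtain ⟨V, ⟨hV, hVc⟩, hVV⟩ := (LocallyConvexSpace.convex_basis_zero ℝ X).mem_iff.1 hV₀
  have hu := isCompact_Icc.uniformContinuousOn_of_continuous hf
  obtain ⟨δ, hδ, hfδ⟩ := ((Metric.uniformity_basis_dist.uniformContinuousOn_iff
    (uniformity X).basis_sets).1 hu) {p | p.2 - p.1 ∈ V}
    (by rw [uniformity_eq_comap_nhds_zero]; exact ⟨V, hV, subset_rfl⟩)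
  obtain ⟨N, hN⟩ := exists_pow_lt_of_lt_one hδ (by norm_num : (2⁻¹ : ℝ) < 1)
  refine ⟨N, fun n hn => ?_⟩
  obtain ⟨j, rfl⟩ := Nat.exists_eq_add_of_le hn
  have hsym : dyadicMean f (N + j) - dyadicMean f N ∈ -V := by
    rw [dyadicMean_add_sub]
    refine sum_dyadic_mem hVc.neg _ _ fun k hk => ?_
    rw [Set.mem_neg, neg_sub]
    have hdiv : k / 2 ^ j < 2 ^ N := by
      rw [Nat.div_lt_iff_lt_mul (by positivity), ← pow_add]
      exact hk
    refine hfδ _ (div_two_pow_mem_Icc hk) _ (div_two_pow_mem_Icc hdiv) ?_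
    refine lt_of_le_of_lt ?_ hN
    have h1 : ((k / 2 ^ j : ℕ) : ℝ) * 2 ^ j ≤ k := by exact_mod_cast Nat.div_mul_le_self k (2 ^ j)
    have h2 : (k : ℝ) ≤ ((k / 2 ^ j : ℕ) : ℝ) * 2 ^ j + 2 ^ j := by
      exact_mod_cast (Nat.lt_div_mul_add (a := k) (b := 2 ^ j) (by positivity)).le
    have e : (k / 2 ^ (N + j) : ℝ) - ((k / 2 ^ j : ℕ) : ℝ) / 2 ^ N =
        (k - ((k / 2 ^ j : ℕ) : ℝ) * 2 ^ j) / 2 ^ j * 2⁻¹ ^ N := by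
      rw [pow_add, inv_pow]
      field_simp
    simp only [Real.dist_eq]
    rw [e, abs_mul, abs_of_nonneg (a := (2⁻¹ : ℝ) ^ N) (by positivity),
      abs_of_nonneg (div_nonneg (by linarith) (by positivity))]
    refine mul_le_of_le_one_left (by positivity) ?_
    rw [div_le_one (by positivity)]
    linarith
  refine hVW (hVV ?_)
  have := Set.mem_neg.1 hsym
  rwa [neg_sub] at this

/-- The range of a Cauchy sequence is totally bounded, so its closure is closed and bounded, and
quasi-completeness makes it complete. -/
theorem exists_tendsto_dyadicMean [ContinuousSMul ℂ X] [QuasiCompleteSpace ℂ X] {f : ℝ → X}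
    (hf : ContinuousOn f (Icc 0 1)) : ∃ M, Tendsto (dyadicMean f) atTop (𝓝 M) := by
  have hc := cauchySeq_dyadicMean hf
  have hcomp : IsComplete (closure (range (dyadicMean f))) :=
    QuasiCompleteSpace.quasiComplete (𝕜 := ℂ)
      (hc.totallyBounded_range.closure.isVonNBounded ℂ) isClosed_closure
  obtain ⟨M, -, hM⟩ := cauchySeq_tendsto_of_isComplete hcomp
    (fun n => subset_closure (mem_range_self n)) hc
  exact ⟨M, hM⟩

theorem tendsto_dyadicMean_integral {F : Type*} [NormedAddCommGroup F] [NormedSpace ℂ F]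
    [CompleteSpace F] {f : ℝ → F} (hf : ContinuousOn f (Icc 0 1)) :
    Tendsto (dyadicMean f) atTop (𝓝 (∫ s in (0 : ℝ)..1, f s)) := by
  rw [Metric.tendsto_atTop]
  intro ε hε
  have hu := Metric.uniformContinuousOn_iff.1 (isCompact_Icc.uniformContinuousOn_of_continuous hf)
  obtain ⟨δ, hδ, hfδ⟩ := hu (ε / 2) (by positivity)
  obtain ⟨N, hN⟩ := exists_pow_lt_of_lt_one hδ (by norm_num : (2⁻¹ : ℝ) < 1)
  refine ⟨N, fun n hn => ?_⟩
  have hlt : (2 ^ n : ℝ)⁻¹ < δ := by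
    rw [← inv_pow]
    exact (pow_le_pow_of_le_one (by norm_num) (by norm_num) hn).trans_lt hN
  let a : ℕ → ℝ := fun k => k / 2 ^ n
  have ha : ∀ k, a (k + 1) - a k = (2 ^ n : ℝ)⁻¹ := by
    intro k
    simp only [a]
    push_cast
    ring
  have hle : ∀ k, a k ≤ a (k + 1) := fun k => by
    rw [← sub_nonneg, ha]
    positivity
  have hsub : ∀ k < 2 ^ n, Icc (a k) (a (k + 1)) ⊆ Icc 0 1 := by
    intro k hk
    refine Icc_subset_Icc (by positivity) ?_
    simp only [a]
    rw [div_le_one (by positivity)]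
    exact_mod_cast hk
  have hint : ∀ k < 2 ^ n, IntervalIntegrable f volume (a k) (a (k + 1)) := fun k hk =>
    ContinuousOn.intervalIntegrable_of_Icc (hle k) (hf.mono (hsub k hk))
  have hsum := intervalIntegral.sum_integral_adjacent_intervals (μ := volume) hint
  have h0 : a 0 = 0 := by simp [a]
  have h1 : a (2 ^ n) = 1 := by simp [a]
  rw [h0, h1] at hsum
  rw [dist_eq_norm, ← hsum, dyadicMean, ← Finset.sum_sub_distrib]
  refine lt_of_le_of_lt (norm_sum_le_of_le (n := fun _ => ε / 2 * (2 ^ n : ℝ)⁻¹) _ ?_) ?_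
  · intro k hk
    have hk := Finset.mem_range.1 hk
    have e : ((2 ^ n : ℝ)⁻¹) • f (k / 2 ^ n) = ∫ _ in (a k)..(a (k + 1)), f (a k) := by
      rw [intervalIntegral.integral_const, ha]
    rw [e, ← intervalIntegral.integral_sub (by simp) (hint k hk)]
    refine (intervalIntegral.norm_integral_le_of_norm_le_const (C := ε / 2) ?_).trans ?_
    · intro s hs
      rw [uIoc_of_le (hle k)] at hs
      rw [← dist_eq_norm]
      refine (hfδ _ (hsub k hk ⟨le_rfl, hle k⟩) _ (hsub k hk ⟨hs.1.le, hs.2⟩) ?_).le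
      rw [dist_comm, Real.dist_eq, abs_of_nonneg (by linarith [hs.1])]
      linarith [hs.2, ha k]
    · rw [ha, abs_of_pos (by positivity)]
  · rw [Finset.sum_const, Finset.card_range, nsmul_eq_mul]
    push_cast
    have : (2 ^ n : ℝ) ≠ 0 := by positivity
    field_simp
    linarith

end Mean

section IsIntegral

variable {X : Type*} [AddCommGroup X] [Module ℂ X] [TopologicalSpace X]

/-- `C = ∫₀ᵗ f(s) ds` as a limit of Riemann sums. -/
def IsIntegral (f : ℝ → X) (t : ℝ) (C : X) : Prop :=
  ∃ M, Tendsto (dyadicMean fun s => f (t * s)) atTop (𝓝 M) ∧ C = t • M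

theorem mul_mem_Icc {t s : ℝ} (ht : 0 ≤ t) (hs : s ∈ Icc (0 : ℝ) 1) : t * s ∈ Icc 0 t :=
  ⟨mul_nonneg ht hs.1, mul_le_of_le_one_right ht hs.2⟩

theorem continuousOn_comp_mul {Y : Type*} [TopologicalSpace Y] {f : ℝ → Y} {t : ℝ} (ht : 0 ≤ t)
    (hf : ContinuousOn f (Icc 0 t)) : ContinuousOn (fun s => f (t * s)) (Icc 0 1) :=
  hf.comp (by fun_prop) fun _ hs => mul_mem_Icc ht hs

theorem IsIntegral.exists_smul_mem {f : ℝ → X} {t : ℝ} {C : X} (h : IsIntegral f t C)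
    (ht : 0 ≤ t) {V : Set X} (hV : Convex ℝ V) (hc : IsClosed V) (hf : ∀ s ∈ Icc 0 t, f s ∈ V) :
    ∃ M ∈ V, C = t • M := by
  obtain ⟨M, hM, rfl⟩ := h
  refine ⟨M, hc.mem_of_tendsto hM (Eventually.of_forall fun n => ?_), rfl⟩
  exact sum_dyadic_mem hV _ _ fun k hk => hf _ (mul_mem_Icc ht (div_two_pow_mem_Icc hk))

/-- Real-linear maps into Banach spaces turn these Riemann limits into ordinary integrals. Real
linearity is what lets the antilinear elements of `X'` be used too. -/
theorem IsIntegral.apply_eq {F : Type*} [NormedAddCommGroup F] [NormedSpace ℂ F]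
    [CompleteSpace F] {f : ℝ → X} {t : ℝ} {C : X} (h : IsIntegral f t C) (ht : 0 ≤ t)
    (hf : ContinuousOn f (Icc 0 t)) (g : X →ₗ[ℝ] F) (hg : Continuous g) :
    g C = ∫ s in (0 : ℝ)..t, g (f s) := by
  obtain ⟨M, hM, rfl⟩ := h
  have h1 : Tendsto (dyadicMean fun s => g (f (t * s))) atTop (𝓝 (g M)) := by
    refine ((hg.tendsto M).comp hM).congr fun n => ?_
    simp [dyadicMean]
  have h2 := tendsto_nhds_unique h1 (tendsto_dyadicMean_integral
    (continuousOn_comp_mul ht (hg.comp_continuousOn hf)))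
  rw [map_smul, h2, intervalIntegral.smul_integral_comp_mul_left (fun s => g (f s))]
  simp

theorem IsIntegral.antiDual_apply {f : ℝ → X} {t : ℝ} {C : X} (h : IsIntegral f t C) (ht : 0 ≤ t)
    (hf : ContinuousOn f (Icc 0 t)) (μ : AntiDual X) : μ C = ∫ s in (0 : ℝ)..t, μ (f s) := by
  refine h.apply_eq ht hf
    { toFun := μ
      map_add' := map_add μ
      map_smul' := fun r x => ?_ } μ.continuous
  rw [← Complex.coe_smul r x, map_smulₛₗ]
  simp

end IsIntegral

section LocallyConvex

variable {X : Type*} [AddCommGroup X] [Module ℂ X] [UniformSpace X] [IsUniformAddGroup X]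
  [ContinuousSMul ℂ X] [LocallyConvexSpace ℝ X]

theorem exists_isIntegral [QuasiCompleteSpace ℂ X] {f : ℝ → X} {t : ℝ} (ht : 0 ≤ t)
    (hf : ContinuousOn f (Icc 0 t)) : ∃ C, IsIntegral f t C := by
  obtain ⟨M, hM⟩ := exists_tendsto_dyadicMean (continuousOn_comp_mul ht hf)
  exact ⟨t • M, M, hM, rfl⟩

/-- The means `h⁻¹ ∫₀ʰ f(s) ds` tend to `f(0)` as `h → 0+`. -/
theorem tendsto_smul_isIntegral {f : ℝ → X} {C : ℝ → X} (hf : ContinuousWithinAt f (Ici 0) 0)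
    (hC : ∀ h, 0 < h → IsIntegral f h (C h)) :
    Tendsto (fun h : ℝ => h⁻¹ • C h) (𝓝[>] 0) (𝓝 (f 0)) := by
  have : ContinuousConstSMul ℝ X := ⟨fun r =>
    continuous_const_smul (T := X) (r : ℂ)⟩
  rw [tendsto_def]
  intro W hW
  obtain ⟨V₁, hV₁, hV₁c, hV₁W⟩ := exists_mem_nhds_isClosed_subset hW
  obtain ⟨V, ⟨hV, hVc⟩, hVV⟩ := (LocallyConvexSpace.convex_basis (𝕜 := ℝ) (f 0)).mem_iff.1 hV₁
  obtain ⟨δ, hδ, hfδ⟩ := Metric.mem_nhdsWithin_iff.1 (hf hV)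
  filter_upwards [Ioo_mem_nhdsGT hδ] with h hh
  obtain ⟨M, hM, hCM⟩ := (hC h hh.1).exists_smul_mem hh.1.le hVc.closure isClosed_closure
    fun s hs => subset_closure (hfδ ⟨by
      rw [Metric.mem_ball, Real.dist_eq, sub_zero, abs_of_nonneg hs.1]
      exact hs.2.trans_lt hh.2, hs.1⟩)
  rw [mem_preimage, hCM, inv_smul_smul₀ hh.1.ne']
  exact hV₁W (hV₁c.closure_subset_iff.2 hVV hM)

end LocallyConvex

theorem tendsto_of_equicontinuousAt {ι α X Y : Type*} [TopologicalSpace X] [UniformSpace Y]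
    {F : ι → X → Y} {x : X} (hF : EquicontinuousAt F x) {l : Filter α} {i : α → ι} {u : α → X}
    {y : Y} (hu : Tendsto u l (𝓝 x)) (hy : Tendsto (fun a => F (i a) x) l (𝓝 y)) :
    Tendsto (fun a => F (i a) (u a)) l (𝓝 y) := by
  rw [Uniform.tendsto_nhds_right] at hy ⊢
  exact hy.uniformity_trans (fun W hW => (hu.eventually (hF W hW)).mono fun a ha => ha (i a))

/-- A primitive on `[0, ∞)` of a continuous function. -/
theorem hasDerivWithinAt_of_eq_integral {F : Type*} [NormedAddCommGroup F] [NormedSpace ℝ F]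
    [CompleteSpace F] {f G : ℝ → F} (hf : ContinuousOn f (Ici 0))
    (hG : ∀ t, 0 ≤ t → G t = G 0 + ∫ s in (0 : ℝ)..t, f s) {t : ℝ} (ht : 0 ≤ t) :
    HasDerivWithinAt G (f t) (Ici 0) t := by
  -- Clamping extends `f` continuously to the whole line, so that the two-sided fundamental theorem
  -- applies also at `t = 0`.
  have hc : Continuous fun s => f (max s 0) :=
    hf.comp_continuous (by fun_prop) fun s => mem_Ici.2 (le_max_right _ _)
  have hd := (hc.integral_hasStrictDerivAt 0 t).hasDerivAt.const_add (G 0)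
  rw [max_eq_left ht] at hd
  have e : ∀ s, 0 ≤ s → G s = G 0 + ∫ r in (0 : ℝ)..s, f (max r 0) := by
    intro s hs
    rw [hG s hs]
    congr 1
    refine intervalIntegral.integral_congr fun r hr => ?_
    rw [uIcc_of_le hs] at hr
    simp only [max_eq_left hr.1]
  exact hd.hasDerivWithinAt.congr (fun s hs => e s hs) (e t ht)

theorem hasDerivWithinAt_Ici_of_tendsto {F : Type*} [NormedAddCommGroup F] [NormedSpace ℂ F]
    {f : ℝ → F} {f' : F} {s : ℝ}
    (h : Tendsto (fun h : ℝ => (h : ℂ)⁻¹ • (f (s + h) - f s)) (𝓝[>] 0) (𝓝 f')) :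
    HasDerivWithinAt f f' (Ici s) s := by
  rw [← hasDerivWithinAt_Ioi_iff_Ici, hasDerivWithinAt_iff_tendsto_slope' (by simp)]
  have hs : Tendsto (fun y : ℝ => y - s) (𝓝[>] s) (𝓝[>] 0) := by
    refine tendsto_nhdsWithin_of_tendsto_nhds_of_eventually_within _ ?_ ?_
    · have hc : Continuous fun y : ℝ => y - s := by fun_prop
      simpa using (hc.tendsto s).mono_left (nhdsWithin_le_nhds (s := Ioi s))
    · filter_upwards [self_mem_nhdsWithin] with y hy
      exact mem_Ioi.2 (sub_pos.2 (mem_Ioi.1 hy))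
  refine (h.comp hs).congr fun y => ?_
  simp only [Function.comp, slope, vsub_eq_sub, add_sub_cancel]
  rw [← Complex.ofReal_inv, Complex.coe_smul]

/-! ### The semigroup `e^{iTt}` on the Hilbert space and its adjoint on `X`. -/

namespace Data

section Hilbert

variable {E X : Type*} [NormedAddCommGroup E] [InnerProductSpace ℂ E] [CompleteSpace E]
  [AddCommGroup X] [Module ℂ X] [TopologicalSpace X] {D : Data E X}

theorem Assumptions.dense_domain_T (hD : D.Assumptions) : Dense (D.T.domain : Set E) := by
  have : D.T.domain = D.H.domain := inf_eq_left.2 hD.domain_le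
  rw [this]
  exact hD.selfAdjoint.dense_domain

theorem mem_partGraph_adjoint {A : E →ₗ.[ℂ] E} (hA : Dense (A.domain : Set E)) {p : X × X} :
    p ∈ D.partGraph A† ↔
      ∀ x : A.domain, inner ℂ (D.incl p.2) (x : E) = inner ℂ (D.incl p.1) (A x) := by
  constructor
  · rintro ⟨h, hp⟩ x
    rw [← hp]
    exact LinearPMap.adjoint_isFormalAdjoint hA ⟨_, h⟩ x
  · intro h
    have hm : D.incl p.1 ∈ A†.domain := LinearPMap.mem_adjoint_domain_of_exists _ ⟨_, h⟩
    exact ⟨hm, LinearPMap.adjoint_apply_eq hA ⟨_, hm⟩ h⟩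

/-- The functional `φ ↦ (v, φ)` for `v` in the Hilbert space. -/
def embedHilbert (D : Data E X) (v : E) : AntiDual X :=
  ((innerSLFlip ℂ v).comp D.incl : X →L⋆[ℂ] ℂ)

theorem embedHilbert_apply (D : Data E X) (v : E) (φ : X) :
    D.embedHilbert v φ = inner ℂ (D.incl φ) v := rfl

variable {U : ℝ → E →L[ℂ] E}

/-- `U t` commutes with the difference quotients that define the generator. -/
theorem Generates.apply_domain (hU : D.Generates U) {t : ℝ} (ht : 0 ≤ t) (v : D.T.domain) :
    ∃ h : U t v ∈ D.T.domain, D.T ⟨U t v, h⟩ = U t (D.T v) := by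
  have hv := (hU.generator v (Complex.I • D.T v)).2 ⟨v.2, rfl⟩
  have h1 := ((U t).continuous.tendsto _).comp hv
  obtain ⟨h, hh⟩ := (hU.generator (U t v) (U t (Complex.I • D.T v))).1 (by
    refine h1.congr' ?_
    filter_upwards [self_mem_nhdsWithin] with s hs
    have e : U t (U s v) = U s (U t v) := by
      rw [← ContinuousLinearMap.comp_apply, ← hU.add t s ht (le_of_lt hs), add_comm,
        hU.add s t (le_of_lt hs) ht, ContinuousLinearMap.comp_apply]
    simp only [Function.comp, map_smul, map_sub, e])
  refine ⟨h, ?_⟩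
  rw [map_smul] at hh
  exact (smul_right_injective E Complex.I_ne_zero hh).symm

theorem Generates.hasDerivWithinAt (hU : D.Generates U) {t : ℝ} (ht : 0 ≤ t) (v : D.T.domain) :
    HasDerivWithinAt (fun s => U s v) (U t (Complex.I • D.T v)) (Ici t) t := by
  have hv := (hU.generator v (Complex.I • D.T v)).2 ⟨v.2, rfl⟩
  refine hasDerivWithinAt_Ici_of_tendsto ((((U t).continuous.tendsto _).comp hv).congr' ?_)
  filter_upwards [self_mem_nhdsWithin] with s hs
  simp only [Function.comp, map_smul, map_sub, hU.add t s ht (le_of_lt hs),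
    ContinuousLinearMap.comp_apply]

/-- Only the right derivative of the orbit is at hand; for a continuous function this suffices in
the fundamental theorem of calculus. -/
theorem Generates.inner_sub (hU : D.Generates U) {t : ℝ} (ht : 0 ≤ t) (v : D.T.domain) (w : E) :
    inner ℂ w (U t v) - inner ℂ w (v : E) =
      Complex.I * ∫ s in (0 : ℝ)..t, inner ℂ w (U s (D.T v)) := by
  have hc : ∀ x : E, ContinuousOn (fun s => inner ℂ w (U s x)) (Icc 0 t) := fun x =>
    ((innerSL ℂ w).continuous.comp_continuousOn (hU.continuousOn x)).mono Icc_subset_Ici_self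
  have := intervalIntegral.integral_eq_sub_of_hasDeriv_right_of_le ht (hc v)
    (f' := fun s => Complex.I * inner ℂ w (U s (D.T v))) (fun s hs => by
      have h := ((innerSL ℂ w).restrictScalars ℝ).hasFDerivAt.comp_hasDerivWithinAt s
        (hU.hasDerivWithinAt hs.1.le v)
      have e : Complex.I * inner ℂ w (U s (D.T v)) =
          ((innerSL ℂ w).restrictScalars ℝ) (U s (Complex.I • D.T v)) := by
        simp
      rw [e]
      exact (h.mono Ioi_subset_Ici_self))
    ((continuousOn_const.mul (hc _)).intervalIntegrable_of_Icc ht)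
  rw [← intervalIntegral.integral_const_mul, this, hU.zero]
  rfl

/-- `iT ∫₀ᵗ e^{iTs}v ds = e^{iTt}v - v`. -/
theorem Generates.integral_mem (hU : D.Generates U) {t : ℝ} (ht : 0 ≤ t) (v : E) :
    ∃ h : (∫ s in (0 : ℝ)..t, U s v) ∈ D.T.domain,
      D.T ⟨_, h⟩ = -Complex.I • (U t v - v) := by
  let f : ℝ → E := fun s => U (max s 0) v
  have hf : Continuous f :=
    (hU.continuousOn v).comp_continuous (by fun_prop) fun s => mem_Ici.2 (le_max_right _ _)
  let G : ℝ → E := fun τ => ∫ s in (0 : ℝ)..τ, f s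
  have hG : ∀ τ, HasDerivAt G (f τ) τ := fun τ => (hf.integral_hasStrictDerivAt 0 τ).hasDerivAt
  have hGU : ∀ τ, 0 ≤ τ → ∫ s in (0 : ℝ)..τ, U s v = G τ := by
    intro τ hτ
    refine intervalIntegral.integral_congr fun r hr => ?_
    rw [uIcc_of_le hτ] at hr
    simp only [f, max_eq_left hr.1]
  -- Shifting the integration variable gives `U h (G t) = G (t + h) - G h`, so the quotient is a
  -- difference of difference quotients of the primitive at `t` and at `0`.
  have hlim : Tendsto (fun h : ℝ => (h : ℂ)⁻¹ • (U h (G t) - G t)) (𝓝[>] 0) (𝓝 (U t v - v)) := by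
    have h1 := ((hG t).tendsto_slope_zero_right.sub (hG 0).tendsto_slope_zero_right)
    have e : f t - f 0 = U t v - v := by
      simp only [f, max_eq_left ht, max_self, hU.zero]
      rfl
    rw [e] at h1
    refine h1.congr' ?_
    filter_upwards [self_mem_nhdsWithin] with h hh
    have hh0 : (0 : ℝ) ≤ h := le_of_lt hh
    have e1 : U h (G t) = G (t + h) - G h := by
      have i1 : ∫ s in (0 : ℝ)..t, U h (f s) = ∫ s in (0 : ℝ)..t, f (s + h) := by
        refine intervalIntegral.integral_congr fun r hr => ?_
        rw [uIcc_of_le ht] at hr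
        simp only [f, max_eq_left hr.1, max_eq_left (add_nonneg hr.1 hh0)]
        rw [add_comm, hU.add h r hh0 hr.1]
        rfl
      rw [← ContinuousLinearMap.intervalIntegral_comp_comm _ (hf.intervalIntegrable _ _), i1,
        intervalIntegral.integral_comp_add_right, zero_add,
        intervalIntegral.integral_interval_sub_left (hf.intervalIntegrable _ _)
          (hf.intervalIntegrable _ _)]
    have e2 : G 0 = 0 := intervalIntegral.integral_same
    rw [e1, ← smul_sub, zero_add, e2, ← Complex.ofReal_inv, Complex.coe_smul]
    congr 1
    abel
  rw [hGU t ht]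
  obtain ⟨h, hh⟩ := (hU.generator _ _).1 hlim
  refine ⟨h, ?_⟩
  rw [hh, smul_smul]
  simp

theorem IsOrbit.zero (hD : D.Assumptions) (hU : D.Generates U) {ψ : X} {c : ℝ → X}
    (hc : D.IsOrbit U ψ c) : c 0 = ψ := by
  apply hD.injective
  rw [hc.2 0 le_rfl, hU.zero]
  rfl

theorem IsOrbit.mem_partGraph (hU : D.Generates U) {ψ : X} {c : ℝ → X}
    (hc : D.IsOrbit U ψ c) {t : ℝ} (ht : 0 ≤ t) {C : X} (hC : IsIntegral c t C) :
    (C, -Complex.I • (c t - ψ)) ∈ D.partGraph D.T := by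
  have h1 : D.incl C = ∫ s in (0 : ℝ)..t, U s (D.incl ψ) := by
    rw [← ContinuousLinearMap.coe_coe, ← LinearMap.coe_restrictScalars ℝ,
      hC.apply_eq ht (hc.1.mono Icc_subset_Ici_self) _ D.incl.continuous]
    refine intervalIntegral.integral_congr fun r hr => ?_
    rw [uIcc_of_le ht] at hr
    exact hc.2 r hr.1
  obtain ⟨h, hh⟩ := hU.integral_mem ht (D.incl ψ)
  simp only [← h1] at h hh
  refine ⟨h, ?_⟩
  rw [hh, map_smul, map_sub, hc.2 t ht]

end Hilbert

section Semigroup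

variable {E X : Type*} [NormedAddCommGroup E] [InnerProductSpace ℂ E] [CompleteSpace E]
  [AddCommGroup X] [Module ℂ X] [TopologicalSpace X] {D : Data E X}
  {U : ℝ → E →L[ℂ] E} {S : ℝ → X →L[ℂ] X}

theorem AdjointSemigroup.inner_apply (hS : D.AdjointSemigroup U S) {t : ℝ} (ht : 0 ≤ t) (φ : X)
    (v : E) : inner ℂ (D.incl (S t φ)) v = inner ℂ (D.incl φ) (U t v) := by
  rw [hS.restrict t ht, ContinuousLinearMap.adjoint_inner_left]

theorem AdjointSemigroup.zero (hD : D.Assumptions) (hU : D.Generates U)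
    (hS : D.AdjointSemigroup U S) (φ : X) : S 0 φ = φ := by
  apply hD.injective
  refine ext_inner_right ℂ fun v => ?_
  rw [hS.inner_apply le_rfl, hU.zero]
  rfl

theorem AdjointSemigroup.add (hD : D.Assumptions) (hU : D.Generates U)
    (hS : D.AdjointSemigroup U S) {s t : ℝ} (hs : 0 ≤ s) (ht : 0 ≤ t) (φ : X) :
    S (s + t) φ = S s (S t φ) := by
  apply hD.injective
  refine ext_inner_right ℂ fun v => ?_
  rw [hS.inner_apply (add_nonneg hs ht), hS.inner_apply hs, hS.inner_apply ht, add_comm,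
    hU.add t s ht hs]
  rfl

/-- The operators `S t` commute with the part of `T^*`. -/
theorem AdjointSemigroup.map_part (hD : D.Assumptions) (hU : D.Generates U)
    (hS : D.AdjointSemigroup U S) {t : ℝ} (ht : 0 ≤ t) {p : X × X} (hp : p ∈ D.partGraph D.T†) :
    (S t p.1, S t p.2) ∈ D.partGraph D.T† := by
  rw [mem_partGraph_adjoint hD.dense_domain_T] at hp ⊢
  intro x
  obtain ⟨h, hh⟩ := hU.apply_domain ht x
  rw [hS.inner_apply ht, hS.inner_apply ht, ← hh]
  exact hp ⟨_, h⟩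

/-- Paired with `T x`, the integral becomes `∫₀ᵗ (φ, U s T x) ds`, so the statement is
`Generates.inner_sub` moved to the adjoint side. -/
theorem AdjointSemigroup.integral_mem (hD : D.Assumptions) (hU : D.Generates U)
    (hS : D.AdjointSemigroup U S) {t : ℝ} (ht : 0 ≤ t) {φ C : X}
    (hC : IsIntegral (fun s => S s φ) t C) :
    (C, Complex.I • (S t φ - φ)) ∈ D.partGraph D.T† := by
  rw [mem_partGraph_adjoint hD.dense_domain_T]
  intro x
  have h1 := hC.antiDual_apply ht ((hS.continuousOn φ).mono Icc_subset_Ici_self)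
    (D.embedHilbert (D.T x))
  simp only [embedHilbert_apply] at h1
  rw [h1, map_smul, map_sub, inner_smul_left, inner_sub_left, hS.inner_apply ht,
    hU.inner_sub ht x, Complex.conj_I, ← mul_assoc, neg_mul, Complex.I_mul_I, neg_neg, one_mul]
  refine intervalIntegral.integral_congr fun s hs => ?_
  rw [uIcc_of_le ht] at hs
  exact (hS.inner_apply hs.1 _ _).symm

/-- Since `X` embeds in the Hilbert space, it is enough to test against the dense domain of `T`,
where `Generates.inner_sub` applies again. -/
theorem AdjointSemigroup.sub_eq (hD : D.Assumptions) (hU : D.Generates U)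
    (hS : D.AdjointSemigroup U S) {t : ℝ} (ht : 0 ≤ t) {p : X × X} (hp : p ∈ D.partGraph D.T†)
    {C : X} (hC : IsIntegral (fun s => S s p.2) t C) : S t p.1 - p.1 = -Complex.I • C := by
  apply hD.injective
  refine hD.dense_domain_T.eq_of_inner_left ℂ fun v hv => ?_
  have h1 := hC.antiDual_apply ht ((hS.continuousOn p.2).mono Icc_subset_Ici_self)
    (D.embedHilbert v)
  simp only [embedHilbert_apply] at h1
  rw [map_smul, map_sub, inner_smul_left, inner_sub_left, hS.inner_apply ht, h1,
    hU.inner_sub ht ⟨v, hv⟩, map_neg, Complex.conj_I, neg_neg]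
  congr 1
  refine intervalIntegral.integral_congr fun s hs => ?_
  rw [uIcc_of_le ht] at hs
  rw [mem_partGraph_adjoint hD.dense_domain_T] at hp
  obtain ⟨h, hh⟩ := hU.apply_domain hs.1 ⟨v, hv⟩
  rw [hS.inner_apply hs.1, ← hh]
  exact (hp ⟨_, h⟩).symm

end Semigroup

section Uniform

variable {E X : Type*} [NormedAddCommGroup E] [InnerProductSpace ℂ E] [CompleteSpace E]
  [AddCommGroup X] [Module ℂ X] [UniformSpace X] [ContinuousSMul ℂ X]
  {D : Data E X} {U : ℝ → E →L[ℂ] E} {S : ℝ → X →L[ℂ] X}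

/-- Equicontinuity upgrades strong continuity to joint continuity. The factor `e^{-βt}` is inserted
to use it and divided out afterwards. -/
theorem AdjointSemigroup.continuousOn_uncurry (hS : D.AdjointSemigroup U S)
    (hS' : QuasiEquicontinuous S) :
    ContinuousOn (fun p : ℝ × X => S p.1 p.2) (Ici 0 ×ˢ univ) := by
  obtain ⟨β, hβ⟩ := hS'
  rintro ⟨t, φ⟩ ⟨ht, -⟩
  let F : Ici (0 : ℝ) → X → X := fun s φ => (Real.exp (-β * s) : ℂ) • S s φ
  let i : ℝ × X → Ici (0 : ℝ) := fun p => ⟨max p.1 0, mem_Ici.2 (le_max_right _ _)⟩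
  have hfst : Tendsto Prod.fst (𝓝[Ici 0 ×ˢ univ] (t, φ)) (𝓝[Ici (0 : ℝ)] t) := by
    rw [nhdsWithin_prod_eq]
    exact tendsto_fst
  have hsnd : Tendsto Prod.snd (𝓝[Ici (0 : ℝ) ×ˢ univ] (t, φ)) (𝓝 φ) :=
    (continuous_snd.tendsto (t, φ)).mono_left nhdsWithin_le_nhds
  have hmem : ∀ᶠ p in 𝓝[Ici (0 : ℝ) ×ˢ univ] (t, φ), 0 ≤ p.1 := by
    filter_upwards [self_mem_nhdsWithin] with p hp
    exact hp.1
  have h1 : Tendsto (fun p => F (i p) φ) (𝓝[Ici 0 ×ˢ univ] (t, φ))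
      (𝓝 ((Real.exp (-β * t) : ℂ) • S t φ)) := by
    have hc : ContinuousOn (fun s : ℝ => (Real.exp (-β * s) : ℂ) • S s φ) (Ici 0) :=
      ContinuousOn.smul (by fun_prop) (hS.continuousOn φ)
    refine ((hc t ht).tendsto.comp hfst).congr' ?_
    filter_upwards [hmem] with p hp
    simp only [Function.comp, F, i, max_eq_left hp]
  have h2 := tendsto_of_equicontinuousAt (hβ φ) hsnd h1
  have h3 : Tendsto (fun p : ℝ × X => (Real.exp (β * p.1) : ℂ)) (𝓝[Ici 0 ×ˢ univ] (t, φ))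
      (𝓝 (Real.exp (β * t) : ℂ)) := by
    have hc : Continuous fun s : ℝ => (Real.exp (β * s) : ℂ) := by fun_prop
    exact (hc.tendsto t).comp (hfst.mono_right nhdsWithin_le_nhds)
  have h4 := h3.smul h2
  have e : ∀ s : ℝ, ∀ x : X, (Real.exp (β * s) : ℂ) • (Real.exp (-β * s) : ℂ) • x = x := by
    intro s x
    rw [smul_smul, ← Complex.ofReal_mul, ← Real.exp_add]
    simp
  rw [e] at h4
  refine h4.congr' ?_
  filter_upwards [hmem] with p hp
  simp only [i, max_eq_left hp]
  exact e _ _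

variable [IsUniformAddGroup X] [LocallyConvexSpace ℝ X] [QuasiCompleteSpace ℂ X]

theorem AdjointSemigroup.exists_isIntegral (hS : D.AdjointSemigroup U S) {t : ℝ} (ht : 0 ≤ t)
    (φ : X) : ∃ C, IsIntegral (fun s => S s φ) t C :=
  Rigged.exists_isIntegral ht ((hS.continuousOn φ).mono Icc_subset_Ici_self)

theorem AdjointSemigroup.tendsto_integral (hD : D.Assumptions) (hU : D.Generates U)
    (hS : D.AdjointSemigroup U S) (φ : X) : ∃ C : ℝ → X,
      (∀ h, 0 < h → IsIntegral (fun s => S s φ) h (C h)) ∧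
      Tendsto (fun h : ℝ => (h : ℂ)⁻¹ • C h) (𝓝[>] 0) (𝓝 φ) := by
  choose! C hC using fun (h : ℝ) (hh : 0 < h) => hS.exists_isIntegral hh.le φ
  refine ⟨C, hC, ?_⟩
  have := tendsto_smul_isIntegral (hS.continuousOn φ 0 self_mem_Ici) hC
  rw [hS.zero hD hU] at this
  refine this.congr fun h => ?_
  rw [← Complex.ofReal_inv, Complex.coe_smul]

theorem AdjointSemigroup.tendsto_slope (hD : D.Assumptions) (hU : D.Generates U)
    (hS : D.AdjointSemigroup U S) {p : X × X} (hp : p ∈ D.partGraph D.T†) :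
    Tendsto (fun h : ℝ => (h : ℂ)⁻¹ • (S h p.1 - p.1)) (𝓝[>] 0) (𝓝 (-Complex.I • p.2)) := by
  obtain ⟨C, hC, hlim⟩ := hS.tendsto_integral hD hU p.2
  refine (hlim.const_smul (-Complex.I)).congr' ?_
  filter_upwards [self_mem_nhdsWithin] with h hh
  rw [hS.sub_eq hD hU (le_of_lt hh) hp (hC h hh), smul_comm]

/-- The means `h⁻¹ ∫₀ʰ S s φ ds` lie in the part of `T^*` and tend to `φ`. -/
theorem AdjointSemigroup.dense_part (hD : D.Assumptions) (hU : D.Generates U)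
    (hS : D.AdjointSemigroup U S) : Dense {φ : X | ∃ χ, (φ, χ) ∈ D.partGraph D.T†} := by
  intro φ
  obtain ⟨C, hC, hlim⟩ := hS.tendsto_integral hD hU φ
  refine mem_closure_of_tendsto hlim ?_
  filter_upwards [self_mem_nhdsWithin] with h hh
  have := hS.integral_mem hD hU (le_of_lt hh) (hC h hh)
  refine ⟨(h : ℂ)⁻¹ • Complex.I • (S h φ - φ), ?_⟩
  rw [mem_partGraph_adjoint hD.dense_domain_T] at this ⊢
  intro x
  simp only at this ⊢
  rw [map_smul, map_smul D.incl _ (C h), inner_smul_left, inner_smul_left, this]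

end Uniform

end Data

/-! ### The action of `T^×` on `A(λ)iψ` and on the generalized resolvent. -/

namespace Data

section Dual

variable {E X : Type*} [NormedAddCommGroup E] [InnerProductSpace ℂ E] [CompleteSpace E]
  [AddCommGroup X] [Module ℂ X] [TopologicalSpace X] {D : Data E X}

theorem continuous_embed_apply (D : Data E X) (φ : X) : Continuous fun ψ => D.embed ψ φ :=
  (innerSL ℂ (D.incl φ)).continuous.comp D.incl.continuous

/-- `T^× A(λ) iψ = λ A(λ) iψ - i(ψ - χ)` where `iχ = K^× A(λ) iψ`. -/
theorem IsA.isDual (hD : D.Assumptions) {l : ℂ} (hl : l ∈ D.extDomain) {ψ χ : X}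
    {μ : AntiDual X} (h : D.IsA l ψ μ) (hK : D.IsDual D.K μ (D.embed χ)) {p : X × X}
    (hp : p ∈ D.partGraph D.T†) : μ p.2 = l * μ p.1 - D.embed (ψ - χ) p.1 := by
  -- The relation is closed in `X × X`, so it need only be checked on the sum of the parts of `H`
  -- and `K^*`, whose closure contains the part of `T^*`.
  have hcl : IsClosed {p : X × X | μ p.2 = l * μ p.1 - D.embed (ψ - χ) p.1} :=
    isClosed_eq (μ.continuous.comp continuous_snd)
      ((continuous_const.mul (μ.continuous.comp continuous_fst)).sub
        ((D.embed (ψ - χ)).continuous.comp continuous_fst))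
  refine hcl.closure_subset_iff.2 ?_ (hD.adjoint_eq hp)
  rintro ⟨φ, η⟩ ⟨χ₁, χ₂, h₁, h₂, he⟩
  have e1 := h.apply_part hD hl h₁
  have e2 := hK _ h₂
  simp only [embed_apply] at e1 e2 he
  simp only [mem_ofPred_eq, he, map_add, e1, ← e2, embed_apply, map_sub, inner_sub_right]
  ring

/-- `T^× ℛ_λ iψ = λ ℛ_λ iψ - iψ`. -/
theorem IsGenResolvent.isDual (hD : D.Assumptions) {l : ℂ} (hl : l ∈ D.extDomain)
    {R : X →ₗ[ℂ] AntiDual X} (hR : D.IsGenResolvent l R) (ψ : X) :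
    D.IsDual D.T (R ψ) (l • R ψ - D.embed ψ) := by
  intro p hp
  have hcl : IsClosed {η : X | R η p.2 = l * R η p.1 - D.embed η p.1} :=
    isClosed_eq (hR.continuous _)
      ((continuous_const.mul (hR.continuous _)).sub (D.continuous_embed_apply _))
  refine (hcl.closure_subset_iff.2 ?_ (hR.dense ψ) : ψ ∈ {η | _}).symm
  rintro η ⟨ψ', μ, χ, hA, hK, rfl⟩
  simp only [mem_ofPred_eq, hR.eq ψ' μ χ hA hK]
  exact hA.isDual hD hl hK hp

/-- `ℛ_λ i(λ - T)φ = iφ` for `φ` in the part of `T`, if `T = H + K` in `X`. -/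
theorem IsGenResolvent.apply_smul_sub (hD : D.Assumptions) {l : ℂ}
    {R : X →ₗ[ℂ] AntiDual X} (hR : D.IsGenResolvent l R)
    [IsTopologicalAddGroup X] [ContinuousSMul ℂ X]
    (hT : D.partGraph D.T ⊆ closure (D.sumGraph D.H D.K)) {p : X × X}
    (hp : p ∈ D.partGraph D.T) : R (l • p.1 - p.2) = D.embed p.1 := by
  ext φ
  have hcl : IsClosed {p : X × X | R (l • p.1 - p.2) φ = D.embed p.1 φ} := by
    refine isClosed_eq ((hR.continuous φ).comp ?_)
      ((D.continuous_embed_apply φ).comp continuous_fst)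
    fun_prop
  refine hcl.closure_subset_iff.2 ?_ (hT hp)
  rintro ⟨ψ, η⟩ ⟨χ₁, χ₂, h₁, ⟨h₂, e₂⟩, he⟩
  -- On embedded vectors `K^× iψ = iKψ`; hence `(λ - H)ψ - Kψ` is in the range of `id - K^× A(λ)`,
  -- where the resolvent is explicit.
  have hK : D.IsDual D.K (D.embed ψ) (D.embed χ₂) := by
    intro q hq
    rw [mem_partGraph_adjoint hD.dense_K] at hq
    simp only [embed_apply]
    simp only at e₂ h₂
    rw [hq ⟨_, h₂⟩, e₂]
  have := hR.eq _ _ _ (isA_smul_sub hD l h₁) hK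
  simp only at he this
  rw [mem_ofPred_eq, he, ← this]
  simp only [sub_sub]

theorem genResolvent_spec {l : ℂ} (hl : l ∈ D.genResolventSet) :
    l ∈ D.extDomain ∧ D.IsGenResolvent l (D.genResolvent l) := by
  obtain ⟨V, hV, hVD, hex, -⟩ := hl
  have h := hex l (mem_of_mem_nhds hV)
  refine ⟨hVD (mem_of_mem_nhds hV), ?_⟩
  rw [genResolvent, dif_pos h]
  exact h.choose_spec

theorem IsDual.dualSemigroup {U : ℝ → E →L[ℂ] E} {S : ℝ → X →L[ℂ] X}
    (hD : D.Assumptions) (hU : D.Generates U) (hS : D.AdjointSemigroup U S) {μ ν : AntiDual X} (h : D.IsDual D.T μ ν) {t : ℝ} (ht : 0 ≤ t) :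
    D.IsDual D.T (Data.dualSemigroup S t μ) (Data.dualSemigroup S t ν) := fun _ hp =>
  h _ (hS.map_part hD hU ht hp)

end Dual

/-! ### Existence and uniqueness for `dξ/dt = iT^×ξ`, and its consequences. -/

section Solutions

variable {E X : Type*} [NormedAddCommGroup E] [InnerProductSpace ℂ E] [CompleteSpace E]
  [AddCommGroup X] [Module ℂ X] [UniformSpace X] [IsUniformAddGroup X] [ContinuousSMul ℂ X]
  [LocallyConvexSpace ℝ X] [QuasiCompleteSpace ℂ X]
  {D : Data E X} {U : ℝ → E →L[ℂ] E} {S : ℝ → X →L[ℂ] X}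

theorem IsDual.hasDerivWithinAt (hD : D.Assumptions) (hU : D.Generates U)
    (hS : D.AdjointSemigroup U S) {μ ν : AntiDual X} (h : D.IsDual D.T μ ν) (φ : X) {t : ℝ}
    (ht : 0 ≤ t) : HasDerivWithinAt (fun s => Data.dualSemigroup S s μ φ)
      (Complex.I * Data.dualSemigroup S t ν φ) (Ici 0) t := by
  refine hasDerivWithinAt_of_eq_integral (f := fun s => Complex.I * Data.dualSemigroup S s ν φ)
    (continuousOn_const.mul (ν.continuous.comp_continuousOn (hS.continuousOn φ))) ?_ ht
  intro s hs
  obtain ⟨C, hC⟩ := hS.exists_isIntegral hs φ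
  have h1 := h _ (hS.integral_mem hD hU hs hC)
  have h2 := hC.antiDual_apply hs ((hS.continuousOn φ).mono Icc_subset_Ici_self) ν
  simp only [map_smulₛₗ, Complex.conj_I, map_sub, smul_eq_mul] at h1
  rw [intervalIntegral.integral_const_mul]
  simp only [Data.dualSemigroup, ContinuousLinearMap.comp_apply, hS.zero hD hU]
  rw [← h2, h1]
  linear_combination (μ (S s φ) - μ φ) * Complex.I_mul_I

theorem IsDual.isWeakSolution (hD : D.Assumptions) (hU : D.Generates U)
    (hS : D.AdjointSemigroup U S) {μ ν : AntiDual X} (h : D.IsDual D.T μ ν) :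
    D.IsWeakSolution (fun t => Data.dualSemigroup S t μ) μ := by
  refine ⟨?_, fun t ht => ⟨_, h.dualSemigroup hD hU hS ht, fun φ =>
    h.hasDerivWithinAt hD hU hS φ ht⟩⟩
  ext φ
  exact congrArg μ (hS.zero hD hU φ)

/-- The weak derivative `I * ν (S r φ)` is jointly continuous, hence continuous in `r` uniformly for
`φ` in the compact closure of a bounded set. The mean value inequality transfers this uniformity to
the difference quotients. -/
theorem IsDual.isStrongSolution [T1Space X] [MontelSpace ℂ X] (hD : D.Assumptions)
    (hU : D.Generates U) (hS : D.AdjointSemigroup U S) (hS' : QuasiEquicontinuous S)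
    {μ ν : AntiDual X} (h : D.IsDual D.T μ ν) :
    D.IsStrongSolution (fun t => Data.dualSemigroup S t μ) μ := by
  refine ⟨(h.isWeakSolution hD hU hS).1, fun t ht => ⟨_, h.dualSemigroup hD hU hS ht, ?_⟩⟩
  refine (UniformConvergenceCLM.tendsto_iff_tendstoUniformlyOn _ _
    {B : Set X | Bornology.IsVonNBounded ℂ B}).2 fun B hB => ?_
  rw [Metric.tendstoUniformlyOn_iff]
  intro ε hε
  have hK : IsCompact (closure B) :=
    MontelSpace.isCompact_of_isClosed_of_isVonNBounded ℂ isClosed_closure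
      (Bornology.IsVonNBounded.closure hB)
  have hc : ContinuousOn (Function.uncurry fun s φ => ν (S s φ)) (Ici 0 ×ˢ closure B) :=
    ν.continuous.comp_continuousOn
      ((hS.continuousOn_uncurry hS').mono (prod_mono_right (subset_univ _)))
  obtain ⟨V, hV, hVε⟩ := hK.mem_uniformity_of_prod hc (mem_Ici.2 ht)
    (Metric.dist_mem_uniformity (half_pos hε))
  obtain ⟨δ, hδ, hδV⟩ := Metric.mem_nhdsWithin_iff.1 hV
  have hball : Metric.ball t δ ∈ 𝓝[Ici 0 \ {t}] t :=
    nhdsWithin_le_nhds (Metric.ball_mem_nhds t hδ)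
  filter_upwards [hball, self_mem_nhdsWithin] with s hs hs' φ hφ
  have hst : s - t ≠ 0 := sub_ne_zero.2 hs'.2
  have hstC : ((s - t : ℝ) : ℂ) ≠ 0 := by exact_mod_cast hst
  have hconv : Convex ℝ (Metric.ball t δ ∩ Ici 0) := (convex_ball t δ).inter (convex_Ici 0)
  set c : ℂ := Complex.I * ν (S t φ) with hcdef
  -- Subtracting the linear function with slope `c`, the derivative at `t`, leaves a function whose
  -- derivative is at most `ε / 2` near `t`.
  have hbound := hconv.norm_image_sub_le_of_norm_hasDerivWithin_le
    (f := fun r : ℝ => μ (S r φ) - ((r : ℝ) : ℂ) * c)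
    (f' := fun r => Complex.I * ν (S r φ) - 1 * c) (C := ε / 2)
    (fun r hr => (((h.hasDerivWithinAt hD hU hS φ hr.2).mono inter_subset_right).sub
      ((Complex.ofRealCLM.hasDerivAt.hasDerivWithinAt).mul_const c)))
    (fun r hr => by
      have := hVε r (hδV hr) φ (subset_closure hφ)
      rw [one_mul, hcdef, ← mul_sub, norm_mul, Complex.norm_I, one_mul, ← dist_eq_norm]
      exact le_of_lt this)
    ⟨Metric.mem_ball_self hδ, ht⟩ ⟨hs, hs'.1⟩
  rw [dist_eq_norm, norm_sub_rev]
  have e : (((s - t : ℝ) : ℂ)⁻¹ • (Data.dualSemigroup S s μ - Data.dualSemigroup S t μ)) φ -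
      (Complex.I • Data.dualSemigroup S t ν) φ =
      ((s - t : ℝ) : ℂ)⁻¹ * ((μ (S s φ) - (s : ℂ) * c) - (μ (S t φ) - (t : ℂ) * c)) := by
    change ((s - t : ℝ) : ℂ)⁻¹ * (μ (S s φ) - μ (S t φ)) - c = _
    field_simp
    push_cast
    ring
  refine lt_of_le_of_lt (le_of_eq (congrArg norm e)) ?_
  rw [norm_mul, norm_inv, Complex.norm_real]
  calc ‖s - t‖⁻¹ * _ ≤ ‖s - t‖⁻¹ * (ε / 2 * ‖s - t‖) := by gcongr
    _ = ε / 2 := by field_simp [norm_ne_zero_iff.2 hst]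
    _ < ε := half_lt_self hε

variable [BarrelledSpace ℂ X]

/-- Weak solutions of `dξ/dt = iT^× ξ` are unique. -/
theorem IsWeakSolution.eq_dualSemigroup (hD : D.Assumptions) (hU : D.Generates U)
    (hS : D.AdjointSemigroup U S) (hS' : QuasiEquicontinuous S) {ξ : ℝ → AntiDual X}
    {μ : AntiDual X} (hξ : D.IsWeakSolution ξ μ) {t : ℝ} (ht : 0 ≤ t) :
    ξ t = Data.dualSemigroup S t μ := by
  have hcont : ∀ φ, ContinuousOn (fun s => ξ s φ) (Ici 0) := fun φ s hs => by
    obtain ⟨ν, -, hν⟩ := hξ.2 s hs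
    exact (hν φ).continuousWithinAt
  -- A weak solution is pointwise bounded on the compact interval `[0, t]`, so Banach–Steinhaus
  -- applies.
  have heq : Equicontinuous ((↑) ∘ fun s : Icc (0 : ℝ) t => ξ s) := by
    refine (PolynormableSpace.banach_steinhaus (𝕜₁ := ℂ) (𝕜₂ := ℂ) fun φ => ?_).equicontinuous
    have hcpt : IsCompact ((fun s => ξ s φ) '' Icc 0 t) :=
      isCompact_Icc.image_of_continuousOn ((hcont φ).mono Icc_subset_Ici_self)
    refine (hcpt.isVonNBounded ℂ).subset ?_
    rintro _ ⟨s, rfl⟩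
    exact ⟨s, s.2, rfl⟩
  have hjoint : ∀ {s : ℝ}, s ∈ Icc 0 t → ∀ {l : Filter ℝ}, l ≤ 𝓝[Icc 0 t] s →
      ∀ {u : ℝ → X} {φ : X}, Tendsto u l (𝓝 φ) →
      Tendsto (fun r => ξ r (u r)) l (𝓝 (ξ s φ)) := by
    intro s hs l hl u φ hu
    have hlim : Tendsto (fun r => ξ (projIcc 0 t ht r) φ) l (𝓝 (ξ s φ)) := by
      refine ((((hcont φ).mono Icc_subset_Ici_self) s hs).tendsto.mono_left hl).congr' ?_
      filter_upwards [hl self_mem_nhdsWithin] with r hr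
      rw [projIcc_of_mem ht hr]
    refine (tendsto_of_equicontinuousAt (heq φ) hu hlim).congr' ?_
    filter_upwards [hl self_mem_nhdsWithin] with r hr
    simp only [Function.comp, projIcc_of_mem ht hr]
  have hSjoint : ∀ {r : ℝ}, 0 ≤ r → ∀ {l : Filter ℝ} {v : ℝ → ℝ} {u : ℝ → X} {φ : X},
      Tendsto v l (𝓝[Ici 0] r) → Tendsto u l (𝓝 φ) →
      Tendsto (fun s => S (v s) (u s)) l (𝓝 (S r φ)) := by
    intro r hr l v u φ hv hu
    have h1 := (hS.continuousOn_uncurry hS') (r, φ) ⟨hr, mem_univ _⟩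
    rw [ContinuousWithinAt, nhdsWithin_prod_eq, nhdsWithin_univ] at h1
    exact h1.comp (hv.prodMk hu)
  have hpart : ∀ φ χ, (φ, χ) ∈ D.partGraph D.T† → ξ t φ = μ (S t φ) := by
    intro φ χ hp
    have hgc : ContinuousOn (fun s => ξ s (S (t - s) φ)) (Icc 0 t) := by
      intro s hs
      refine hjoint hs le_rfl (hSjoint (sub_nonneg.2 hs.2) ?_ tendsto_const_nhds)
      have hc : Continuous fun r : ℝ => t - r := by fun_prop
      refine tendsto_nhdsWithin_of_tendsto_nhds_of_eventually_within _
        ((hc.tendsto s).mono_left nhdsWithin_le_nhds) ?_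
      filter_upwards [self_mem_nhdsWithin] with r hr
      exact mem_Ici.2 (sub_nonneg.2 hr.2)
    have hgd : ∀ s ∈ Ico 0 t,
        HasDerivWithinAt (fun s => ξ s (S (t - s) φ)) 0 (Ici s) s := by
      intro s hs
      have hr : 0 < t - s := sub_pos.2 hs.2
      obtain ⟨ν, hν, hξν⟩ := hξ.2 s hs.1
      have hadd : Tendsto (fun h : ℝ => s + h) (𝓝[>] 0) (𝓝[Icc 0 t] s) := by
        have hc : Continuous fun h : ℝ => s + h := by fun_prop
        refine tendsto_nhdsWithin_of_tendsto_nhds_of_eventually_within _ ?_ ?_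
        · simpa using (hc.tendsto 0).mono_left (nhdsWithin_le_nhds (s := Ioi 0))
        · filter_upwards [Ioo_mem_nhdsGT hr] with h hh
          exact ⟨add_nonneg hs.1 hh.1.le, by linarith [hh.2]⟩
      have hsub : Tendsto (fun h : ℝ => t - s - h) (𝓝[>] 0) (𝓝[Ici 0] (t - s)) := by
        have hc : Continuous fun h : ℝ => t - s - h := by fun_prop
        refine tendsto_nhdsWithin_of_tendsto_nhds_of_eventually_within _ ?_ ?_
        · simpa using (hc.tendsto 0).mono_left (nhdsWithin_le_nhds (s := Ioi 0))
        · filter_upwards [Ioo_mem_nhdsGT hr] with h hh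
          exact mem_Ici.2 (by linarith [hh.2])
      -- Because `S(t-s-h)φ - S(t-s)φ = S(t-s-h)(φ - S(h)φ)`, only the derivative of `S` at `0` is
      -- needed.
      have h1 : Tendsto (fun h : ℝ => S (t - s - h) (-((h : ℂ)⁻¹ • (S h φ - φ)))) (𝓝[>] 0)
          (𝓝 (S (t - s) (Complex.I • χ))) := by
        refine hSjoint hr.le hsub ?_
        simpa using (hS.tendsto_slope hD hU hp).neg
      have h2 : Tendsto (fun h : ℝ => ξ (s + h) (S (t - s - h) (-((h : ℂ)⁻¹ • (S h φ - φ)))))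
          (𝓝[>] 0) (𝓝 (ξ s (S (t - s) (Complex.I • χ)))) := by
        have hm : Tendsto (fun r : ℝ => r - s) (map (fun h : ℝ => s + h) (𝓝[>] 0)) (𝓝[>] 0) := by
          rw [tendsto_map'_iff]
          refine tendsto_id.congr fun h => ?_
          simp
        have := (hjoint ⟨hs.1, hs.2.le⟩ hadd (h1.comp hm)).comp tendsto_map
        refine this.congr fun h => ?_
        simp only [Function.comp, add_sub_cancel_left]
      have h3 : Tendsto (fun h : ℝ => (h : ℂ)⁻¹ * (ξ (s + h) (S (t - s) φ) - ξ s (S (t - s) φ)))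
          (𝓝[>] 0) (𝓝 (Complex.I * ν (S (t - s) φ))) := by
        have := ((hξν (S (t - s) φ)).mono (Ici_subset_Ici.2 hs.1)).Ioi_of_Ici
        rw [hasDerivWithinAt_iff_tendsto_slope' (by simp)] at this
        have hm : Tendsto (fun h : ℝ => s + h) (𝓝[>] 0) (𝓝[>] s) := by
          have hc : Continuous fun h : ℝ => s + h := by fun_prop
          refine tendsto_nhdsWithin_of_tendsto_nhds_of_eventually_within _ ?_ ?_
          · simpa using (hc.tendsto 0).mono_left (nhdsWithin_le_nhds (s := Ioi 0))
          · filter_upwards [self_mem_nhdsWithin] with h hh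
            exact mem_Ioi.2 (lt_add_of_pos_right s (mem_Ioi.1 hh))
        refine (this.comp hm).congr fun h => ?_
        simp only [Function.comp, slope, vsub_eq_sub, add_sub_cancel_left]
        rw [← Complex.coe_smul, Complex.ofReal_inv, smul_eq_mul]
      have h4 := h2.add h3
      -- The two halves of the product rule cancel: `ν = T^×ξ(s)` moves onto `χ = T^*φ`, and
      -- antilinearity turns `I` into `-I`.
      have e0 : ξ s (S (t - s) (Complex.I • χ)) + Complex.I * ν (S (t - s) φ) = 0 := by
        have := hν _ (hS.map_part hD hU hr.le hp)
        simp only at this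
        rw [this, map_smul, map_smulₛₗ, Complex.conj_I, smul_eq_mul]
        ring
      rw [e0] at h4
      refine hasDerivWithinAt_Ici_of_tendsto (h4.congr' ?_)
      filter_upwards [Ioo_mem_nhdsGT hr] with h hh
      have e1 : S (t - s) φ = S (t - s - h) (S h φ) := by
        rw [← hS.add hD hU (by linarith [hh.2]) hh.1.le, sub_add_cancel]
      have e2 : t - (s + h) = t - s - h := by ring
      rw [e2, smul_eq_mul]
      have e3 : S (t - s - h) (-((h : ℂ)⁻¹ • (S h φ - φ))) =
          -((h : ℂ)⁻¹ • (S (t - s) φ - S (t - s - h) φ)) := by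
        rw [map_neg, map_smul, map_sub, ← e1]
      rw [e3, map_neg, map_smulₛₗ, map_inv₀, Complex.conj_ofReal, map_sub, smul_eq_mul]
      ring
    -- The values at the endpoints `t` and `0` are `ξ(t)φ` and `μ(S t φ)`.
    have := constant_of_has_deriv_right_zero hgc hgd t ⟨ht, le_rfl⟩
    simpa [hS.zero hD hU, hξ.1] using this
  refine ContinuousLinearMap.ext fun φ => ?_
  have hcl : IsClosed {φ : X | ξ t φ = μ (S t φ)} :=
    isClosed_eq (ξ t).continuous (μ.continuous.comp (S t).continuous)
  refine hcl.closure_subset_iff.2 ?_ (hS.dense_part hD hU φ)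
  rintro φ ⟨χ, hp⟩
  exact hpart φ χ hp

theorem IsGenEigenfunction.dualSemigroup_eq (hD : D.Assumptions) (hU : D.Generates U)
    (hS : D.AdjointSemigroup U S) (hS' : QuasiEquicontinuous S) {l : ℂ} (hl : l ∈ D.extDomain)
    {μ : AntiDual X} (hμ : D.IsGenEigenfunction l μ) {t : ℝ} (ht : 0 ≤ t) :
    Data.dualSemigroup S t μ = Complex.exp (Complex.I * l * t) • μ := by
  obtain ⟨-, -, χ, hK, hA⟩ := hμ
  -- Here `μ = A(λ)iχ` with `iχ = K^×μ`, so the inhomogeneous term `i(χ - χ)` in `IsA.isDual` is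
  -- zero.
  have hdual : ∀ p ∈ D.partGraph D.T†, l * μ p.1 = μ p.2 := by
    intro p hp
    have := hA.isDual hD hl hK hp
    rw [this, sub_self, embed_apply, map_zero, inner_zero_right, sub_zero]
  refine (IsWeakSolution.eq_dualSemigroup hD hU hS hS'
    (ξ := fun t => Complex.exp (Complex.I * l * t) • μ) ⟨by simp, fun s _ =>
      ⟨Complex.exp (Complex.I * l * s) • l • μ, ?_, ?_⟩⟩ ht).symm
  · intro p hp
    simp only [smul_apply, smul_eq_mul, hdual p hp]
  · intro φ
    have h1 : HasDerivAt (fun s : ℝ => Complex.I * l * s) (Complex.I * l * 1) s :=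
      Complex.ofRealCLM.hasDerivAt.const_mul _
    have h2 := (h1.cexp.mul_const (μ φ)).hasDerivWithinAt (s := Ici 0)
    refine h2.congr_deriv ?_
    simp only [smul_apply, smul_eq_mul]
    ring

theorem IsGenResolvent.dualSemigroup_apply (hD : D.Assumptions) (hU : D.Generates U)
    (hS : D.AdjointSemigroup U S) (hS' : QuasiEquicontinuous S) {l : ℂ} (hl : l ∈ D.extDomain)
    {R : X →ₗ[ℂ] AntiDual X} (hR : D.IsGenResolvent l R)
    (hT : D.partGraph D.T ⊆ closure (D.sumGraph D.H D.K)) {ψ : X} {c : ℝ → X}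
    (hc : D.IsOrbit U ψ c) {t : ℝ} (ht : 0 ≤ t) :
    Data.dualSemigroup S t (R ψ) = R (c t) := by
  have hc0 := hc.zero hD hU
  refine (IsWeakSolution.eq_dualSemigroup hD hU hS hS' (ξ := fun t => R (c t))
    ⟨by simp only [hc0], fun s hs => ⟨_, hR.isDual hD hl (c s), fun φ => ?_⟩⟩ ht).symm
  -- `R` is continuous only into the weak dual topology; fixing `φ` gives a continuous functional,
  -- which may be exchanged with the Riemann integral of the orbit.
  let g : X →ₗ[ℂ] ℂ :=
    { toFun := fun x => l * R x φ - D.embed x φ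
      map_add' := fun x y => by
        simp only [map_add, add_apply, embed_apply, inner_add_right]
        ring
      map_smul' := fun a x => by
        simp only [map_smul, smul_apply, embed_apply, inner_smul_right,
          RingHom.id_apply, smul_eq_mul]
        ring }
  have hg : Continuous g :=
    (continuous_const.mul (hR.continuous φ)).sub (D.continuous_embed_apply φ)
  refine hasDerivWithinAt_of_eq_integral (f := fun s => Complex.I * g (c s))
    (continuousOn_const.mul (hg.comp_continuousOn hc.1)) ?_ hs
  intro r hr
  have hcr : ContinuousOn c (Icc 0 r) := hc.1.mono Icc_subset_Ici_self
  obtain ⟨C, hC⟩ := Rigged.exists_isIntegral hr hcr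
  have h1 := congrArg (fun ν : AntiDual X => ν φ)
    (hR.apply_smul_sub hD hT (hc.mem_partGraph hU hr hC))
  have h2 : g C = ∫ s in (0 : ℝ)..r, g (c s) := hC.apply_eq hr hcr (g.restrictScalars ℝ) hg
  rw [intervalIntegral.integral_const_mul, ← h2]
  simp only [map_sub, map_smul, sub_apply, smul_apply,
    smul_eq_mul] at h1
  simp only [hc0]
  -- With `C = ∫₀ʳ c` and `T C = -i(c(r) - ψ)`, this is the identity `R(λC - TC) = iC` evaluated at
  -- `φ` and solved for `R(c(r))`.
  change R (c r) φ = R ψ φ + Complex.I * (l * R C φ - D.embed C φ)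
  linear_combination -Complex.I * h1 + (R (c r) φ - R ψ φ) * Complex.I_mul_I

/-- The Pettis integral is tested at `S t φ`, so the semigroup passes under it, and the commutation
holds pointwise along the curve. -/
theorem IsRieszProjection.dualSemigroup_apply (hD : D.Assumptions) (hU : D.Generates U)
    (hS : D.AdjointSemigroup U S) (hS' : QuasiEquicontinuous S) {γ : ℝ → ℂ}
    (hγ : ∀ s ∈ Icc (0 : ℝ) 1, γ s ∈ D.genResolventSet) {P : X → AntiDual X}
    (hP : D.IsRieszProjection γ P)
    (hT : D.partGraph D.T ⊆ closure (D.sumGraph D.H D.K)) {ψ : X} {c : ℝ → X}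
    (hc : D.IsOrbit U ψ c) {t : ℝ} (ht : 0 ≤ t) :
    Data.dualSemigroup S t (P ψ) = P (c t) := by
  refine ContinuousLinearMap.ext fun φ => ?_
  rw [(hP (c t) φ).2]
  refine ((hP ψ (S t φ)).2).trans ?_
  congr 1
  refine intervalIntegral.integral_congr fun s hs => ?_
  rw [uIcc_of_le zero_le_one] at hs
  obtain ⟨hl, hR⟩ := genResolvent_spec (hγ s hs)
  simp only [← hR.dualSemigroup_apply hD hU hS hS' hl hT hc ht]
  rfl

end Solutions

end Data

end Rigged

end

theorem proposition3p23 {E X : Type*}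
    [NormedAddCommGroup E] [InnerProductSpace ℂ E] [CompleteSpace E]
    [AddCommGroup X] [Module ℂ X] [UniformSpace X] [IsUniformAddGroup X] [ContinuousSMul ℂ X]
    [LocallyConvexSpace ℝ X] [T2Space X] [QuasiCompleteSpace ℂ X] [BarrelledSpace ℂ X]
    (D : Rigged.Data E X) (hD : D.Assumptions)
    (U : ℝ → E →L[ℂ] E) (hU : D.Generates U)
    (S : ℝ → X →L[ℂ] X) (hS : D.AdjointSemigroup U S)
    (hS' : Rigged.Data.QuasiEquicontinuous S) :
    -- (i)
    (∀ μ, (∃ ν, D.IsDual D.T μ ν) →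
      D.IsWeakSolution (fun t => Rigged.Data.dualSemigroup S t μ) μ ∧
      (∀ ξ, D.IsWeakSolution ξ μ → ∀ t, 0 ≤ t → ξ t = Rigged.Data.dualSemigroup S t μ) ∧
      (MontelSpace ℂ X → D.IsStrongSolution (fun t => Rigged.Data.dualSemigroup S t μ) μ)) ∧
    -- (ii)
    (∀ l ∈ D.extDomain, ∀ μ, D.IsGenEigenfunction l μ → ∀ t, 0 ≤ t →
      Rigged.Data.dualSemigroup S t μ = Complex.exp (Complex.I * l * t) • μ) ∧
    -- (iii)
    (∀ l γ P, D.IsGenEigenvalue l → D.Separates γ l → D.IsRieszProjection γ P →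
      D.partGraph D.T ⊆ closure (D.sumGraph D.H D.K) →
      (∀ ψ c, D.IsOrbit U ψ c → ∀ t, 0 ≤ t →
        Rigged.Data.dualSemigroup S t (D.embed ψ) = D.embed (c t) ∧
        Rigged.Data.dualSemigroup S t (P ψ) = P (c t)) ∧
      ((∀ ψ, ∃ c, D.IsOrbit U ψ c) → ∀ t, 0 ≤ t →
        ∀ μ ∈ Set.range P, Rigged.Data.dualSemigroup S t μ ∈ Set.range P)) := by
  refine ⟨fun μ ⟨ν, hμ⟩ => ⟨hμ.isWeakSolution hD hU hS, fun ξ hξ t ht =>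
    hξ.eq_dualSemigroup hD hU hS hS' ht, fun _ => hμ.isStrongSolution hD hU hS hS'⟩,
    fun l hl μ hμ t ht => hμ.dualSemigroup_eq hD hU hS hS' hl ht,
    fun l γ P _ hγ hP hT => ⟨fun ψ c hc t ht => ⟨?_, ?_⟩, ?_⟩⟩
  · ext φ
    change inner ℂ (D.incl (S t φ)) (D.incl ψ) = inner ℂ (D.incl φ) (D.incl (c t))
    rw [hS.inner_apply ht, hc.2 t ht]
  · exact hP.dualSemigroup_apply hD hU hS hS' hγ.mem hT hc ht
  · rintro h t ht _ ⟨ψ, rfl⟩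
    obtain ⟨c, hc⟩ := h ψ
    exact ⟨c t, (hP.dualSemigroup_apply hD hU hS hS' hγ.mem hT hc ht).symm⟩
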